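/- Let $\Bbbk$ be an algebraically closed field of characteristic $p>3$ and let $\ell\ge 0$ be an integer. Let $W=\operatorname{Der}_{\Bbbk}(\Bbbk[X]/(X^p))$ be the Witt algebra, with basis $e_i=x^{i+1}\partial$ ($-1\le i\le p-2$), where $x$ is the class of $X$, and bracket $[e_i,e_j]=(j-i)e_{i+j}$ (with $e_{i+j}=0$ if $i+j\notin\{-1,\dots,p-2\}$). Let $W_\ell=W\otimes_{\Bbbk}\Bbbk[t]/(t^{\ell+1})$ be the truncated current Lie algebra, with basis $e_it^j=e_i\otimes t^j$ ($-1\le i\le p-2$, $0\le j\le \ell$), restricted by the $p$-map with $(e_it^k)^{[p]}=\delta_{i,0}\,e_it^{kp}$. For $i\ge -1$ put $W_{\ell,(i)}=\operatorname{span}_{\Bbbk}\{e_jt^k : j\ge i,\ 0\le k\le \ell\}$; for $i\ge 0$ this is a restricted subalgebra. The height $r(\chi)$ of $\chi\in W_\ell^*$ is the smallest integer $i\ge -1$ with $\chi(W_{\ell,(i)})=0$. For a restricted Lie algebra $\mathfrak g$ and $\chi\in\mathfrak g^*$, let $U_\chi(\mathfrak g)$ be the quotient of the universal enveloping algebra $U(\mathfrak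 g)$ by the two-sided ideal generated by the elements $y^p-y^{[p]}-\chi(y)^p$, $y\in\mathfrak g$; for a restricted subalgebra $\mathfrak h$ write $U_\chi(\mathfrak h)=U_{\chi|_{\mathfrak h}}(\mathfrak h)$. Theorem. Let $\chi\in W_\ell^*$ have height $r=r(\chi)$ with $1<r<p-1$, assume $\chi(e_{r-1}t^\ell)\neq 0$, and put $s=\lfloor r/2\rfloor$. Then: 1. There is a one-dimensional $U_\chi(W_{\ell,(s)})$-module $\Bbbk_\chi$ on which every $y\in W_{\ell,(s)}$ acts as the scalar $\chi(y)$, and every simple $U_\chi(W_{\ell,(s)})$-module is isomorphic to $\Bbbk_\chi$. 2. The induced module $S=U_\chi(W_\ell)\otimes_{U_\chi(W_{\ell,(s)})}\Bbbk_\chi$ is a simple $U_\chi(W_\ell)$-module, and every simple $U_\chi(W_\ell)$-module is isomorphic to $S$. 3. $\dim_{\Bbbk}S=p^{(\ell+1)(s+1)}$. -/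

import Mathlib

open Polynomial TensorProduct

noncomputable section

/-! ## Truncated polynomial algebras -/

/-- The truncated polynomial algebra `K[X]/(X^n)`. -/
def TruncPoly (K : Type*) [Field K] (n : ℕ) : Type _ := AdjoinRoot (X ^ n : K[X])

namespace TruncPoly

variable (K : Type*) [Field K] (n : ℕ)

instance : CommRing (TruncPoly K n) := inferInstanceAs (CommRing (AdjoinRoot (X ^ n : K[X])))

instance : Algebra K (TruncPoly K n) := inferInstanceAs (Algebra K (AdjoinRoot (X ^ n : K[X])))

/-- The quotient map `K[X] → K[X]/(X^n)`. -/
def mk : K[X] →ₐ[K] TruncPoly K n := AdjoinRoot.mkₐ (X ^ n : K[X])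

/-- The class of `X` in `K[X]/(X^n)`. -/
def gen : TruncPoly K n := mk K n X

theorem mk_surjective : Function.Surjective (mk K n) :=
  AdjoinRoot.mk_surjective (g := (X ^ n : K[X]))

theorem mk_eq_zero (f : K[X]) : mk K n f = 0 ↔ X ^ n ∣ f :=
  AdjoinRoot.mk_eq_zero (f := (X ^ n : K[X]))

theorem gen_pow_eq_zero {m : ℕ} (h : n ≤ m) : gen K n ^ m = 0 := by
  rw [gen, ← map_pow, mk_eq_zero]
  exact pow_dvd_pow X h

theorem mk_monomial (m : ℕ) (c : K) : mk K n (monomial m c) = c • gen K n ^ m := by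
  rw [gen, ← map_pow, ← map_smul, smul_eq_C_mul, C_mul_X_pow_eq_monomial]

theorem adjoin_gen : Algebra.adjoin K {gen K n} = ⊤ := by
  have h := AlgHom.map_adjoin_singleton (mk K n) (X : K[X])
  rw [Polynomial.adjoin_X, Algebra.map_top, (AlgHom.range_eq_top (mk K n)).2 (mk_surjective K n)] at h
  exact h.symm

end TruncPoly

open TruncPoly

/-! ## The Witt algebra and its truncated current algebra -/

/-- The Witt algebra: the Lie algebra of `K`-derivations of `A(1) = K[X]/(X^p)`. -/
abbrev Witt (K : Type*) [Field K] (p : ℕ) : Type _ :=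
  Derivation K (TruncPoly K p) (TruncPoly K p)

namespace Witt

section

variable (K : Type*) [Field K] (p : ℕ) [CharP K p]

theorem mk_derivative_eq_zero (f : K[X]) (hf : mk K p f = 0) :
    mk K p (Polynomial.derivative' f) = 0 := by
  rw [mk_eq_zero] at hf ⊢
  obtain ⟨g, rfl⟩ := hf
  refine ⟨Polynomial.derivative g, ?_⟩
  show Polynomial.derivative (X ^ p * g) = _
  simp [Polynomial.derivative_mul, Polynomial.derivative_X_pow]

/-- The derivation `∂ = d/dx` of `K[X]/(X^p)`, induced by the derivative of polynomials
(it preserves the ideal `(X^p)` because `K` has characteristic `p`). -/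
def del : Witt K p :=
  Derivation.liftOfSurjective (f := mk K p) (mk_surjective K p) (mk_derivative_eq_zero K p)

/-- `e_i = x^(i+1) ∂` for `i ≥ -1` (only used for `-1 ≤ i ≤ p - 2`). -/
def e (i : ℤ) : Witt K p := gen K p ^ (i + 1).toNat • del K p

end

variable {K : Type*} [Field K] {p : ℕ} [CharP K p]

theorem del_mk (f : K[X]) : del K p (mk K p f) = mk K p (Polynomial.derivative f) :=
  Derivation.liftOfSurjective_apply (f := mk K p) (mk_surjective K p)
    (mk_derivative_eq_zero K p) f

theorem del_gen_pow (n : ℕ) : del K p (gen K p ^ n) = (n : K) • gen K p ^ (n - 1) := by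
  rw [gen, ← map_pow, del_mk, Polynomial.derivative_X_pow, ← map_pow, ← map_smul, smul_eq_C_mul]

theorem del_gen : del K p (gen K p) = 1 := by
  simpa using del_gen_pow (K := K) (p := p) 1

theorem smul_del_eq (D : Witt K p) : D (gen K p) • del K p = D := by
  have hs : Set.EqOn (D (gen K p) • del K p) D ({gen K p} : Set (TruncPoly K p)) := by
    intro y hy
    rw [Set.mem_singleton_iff] at hy
    subst hy
    rw [Derivation.smul_apply, del_gen, smul_eq_mul, mul_one]
  exact Derivation.ext_of_adjoin_eq_top _ (adjoin_gen K p) hs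

theorem lie_pow_smul_del (a b : ℕ) :
    ⁅(gen K p ^ a • del K p : Witt K p), (gen K p ^ b • del K p : Witt K p)⁆ =
      ((b : K) - (a : K)) • (gen K p ^ (a + b - 1) • del K p) := by
  have key : ∀ u v : TruncPoly K p, ⁅(u • del K p : Witt K p), (v • del K p : Witt K p)⁆
      = (u * del K p v - v * del K p u) • del K p := by
    intro u v
    ext f
    simp only [Derivation.commutator_apply, Derivation.smul_apply, smul_eq_mul,
      Derivation.leibniz]
    ring
  have hmul : ∀ a b : ℕ, gen K p ^ a * del K p (gen K p ^ b) =
      (b : K) • gen K p ^ (a + b - 1) := by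
    intro a b
    rw [del_gen_pow, mul_smul_comm]
    rcases Nat.eq_zero_or_pos b with rfl | hb
    · simp
    · rw [← pow_add, Nat.add_sub_assoc hb]
  rw [key, hmul, hmul, add_comm b a, ← sub_smul, smul_assoc]

end Witt

/-- The truncated current algebra `W_ℓ = K[t]/(t^(ℓ+1)) ⊗ W`, with Mathlib's Lie bracket
`⁅a ⊗ D, b ⊗ E⁆ = (a * b) ⊗ ⁅D, E⁆` (see `WittCurrent.lie_tmul`). -/
def WittCurrent (K : Type*) [Field K] (p l : ℕ) : Type _ := TruncPoly K (l + 1) ⊗[K] Witt K p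

namespace WittCurrent

section

variable (K : Type*) [Field K] (p l : ℕ)

instance : LieRing (WittCurrent K p l) :=
  inferInstanceAs (LieRing (TruncPoly K (l + 1) ⊗[K] Witt K p))

instance : LieAlgebra K (WittCurrent K p l) :=
  inferInstanceAs (LieAlgebra K (TruncPoly K (l + 1) ⊗[K] Witt K p))

/-- The identity map from the tensor product to `W_ℓ`. -/
def ofTensor : TruncPoly K (l + 1) ⊗[K] Witt K p ≃ₗ[K] WittCurrent K p l :=
  LinearEquiv.refl K (TruncPoly K (l + 1) ⊗[K] Witt K p)

/-- The action of `W_ℓ` on `K[t]/(t^(ℓ+1)) ⊗ A(1)`, given by `(a ⊗ D)(b ⊗ f) = ab ⊗ D f`. -/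
def act : WittCurrent K p l →ₗ[K]
    Module.End (TruncPoly K (l + 1)) (TruncPoly K (l + 1) ⊗[K] TruncPoly K p) :=
  TensorProduct.lift
    (LinearMap.mk₂ K (fun (a : TruncPoly K (l + 1)) (D : Witt K p) =>
      a • LinearMap.baseChange (TruncPoly K (l + 1)) (D : TruncPoly K p →ₗ[K] TruncPoly K p))
      (fun a b D => add_smul a b _) (fun c a D => smul_assoc c a _)
      (fun a D E => by rw [Derivation.coe_add_linearMap, LinearMap.baseChange_add, smul_add])
      (fun c a D => by rw [Derivation.coe_smul_linearMap, LinearMap.baseChange_smul, smul_comm]))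
    ∘ₗ (ofTensor K p l).symm.toLinearMap

end

section

variable {K : Type*} [Field K] {p l : ℕ}

/-- The element `a ⊗ D` of `W_ℓ`. -/
def tmul (a : TruncPoly K (l + 1)) (D : Witt K p) : WittCurrent K p l :=
  ofTensor K p l (a ⊗ₜ[K] D)

theorem lie_tmul (a b : TruncPoly K (l + 1)) (D E : Witt K p) :
    ⁅tmul a D, tmul b E⁆ = tmul (a * b) ⁅D, E⁆ := rfl

@[elab_as_elim]
theorem induction_on {motive : WittCurrent K p l → Prop} (z : WittCurrent K p l)
    (zero : motive 0) (tmul : ∀ a D, motive (tmul a D))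
    (add : ∀ z w, motive z → motive w → motive (z + w)) : motive z :=
  TensorProduct.induction_on (motive := fun z => motive (ofTensor K p l z))
    ((ofTensor K p l).symm z) zero tmul (fun _ _ hx hy => add _ _ hx hy)

theorem act_tmul (a b : TruncPoly K (l + 1)) (D : Witt K p) (f : TruncPoly K p) :
    act K p l (tmul a D) (b ⊗ₜ[K] f) = (a * b) ⊗ₜ[K] D f := rfl

theorem tmul_smul (a : TruncPoly K (l + 1)) (c : K) (D : Witt K p) :
    (tmul a (c • D) : WittCurrent K p l) = c • tmul a D := by
  rw [tmul, TensorProduct.tmul_smul, map_smul, tmul]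

theorem act_leibniz (z : WittCurrent K p l)
    (f g : TruncPoly K (l + 1) ⊗[K] TruncPoly K p) :
    act K p l z (f * g) = act K p l z f * g + f * act K p l z g := by
  induction z using induction_on with
  | zero => simp
  | add z w hz hw => simp only [map_add, LinearMap.add_apply, hz, hw]; ring
  | tmul a D =>
    induction f using TensorProduct.induction_on with
    | zero => simp
    | add f f' hf hf' => rw [add_mul, map_add, map_add, hf, hf']; ring
    | tmul b f =>
      induction g using TensorProduct.induction_on with
      | zero => simp
      | add g g' hg hg' => rw [mul_add, map_add, map_add, hg, hg']; ring
      | tmul c g =>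
        simp only [Algebra.TensorProduct.tmul_mul_tmul, act_tmul, Derivation.leibniz, smul_eq_mul,
          TensorProduct.tmul_add]
        rw [mul_left_comm b a c, ← mul_assoc a b c, mul_comm g (D f)]
        exact add_comm _ _

theorem derivation_ext (D E : Module.End (TruncPoly K (l + 1))
      (TruncPoly K (l + 1) ⊗[K] TruncPoly K p))
    (hD : ∀ a b, D (a * b) = D a * b + a * D b) (hE : ∀ a b, E (a * b) = E a * b + a * E b)
    (h : D (1 ⊗ₜ gen K p) = E (1 ⊗ₜ gen K p)) : D = E := by
  have hpow : ∀ n : ℕ, (D - E) ((1 ⊗ₜ gen K p) ^ n) = 0 := by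
    intro n
    induction n with
    | zero =>
      have h1 := hD 1 1
      have h2 := hE 1 1
      simp only [mul_one, one_mul, left_eq_add] at h1 h2
      simp [h1, h2]
    | succ n ih =>
      rw [LinearMap.sub_apply, sub_eq_zero] at ih ⊢
      rw [pow_succ, hD, hE, ih, h]
  rw [← sub_eq_zero]
  apply TensorProduct.AlgebraTensorModule.ext
  intro b f
  obtain ⟨f, rfl⟩ := mk_surjective K p f
  have hb : ∀ y : TruncPoly K p, (b ⊗ₜ[K] y : TruncPoly K (l + 1) ⊗[K] TruncPoly K p)
      = b • (1 ⊗ₜ[K] y) := by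
    intro y
    simp [TensorProduct.smul_tmul']
  rw [hb, map_smul, LinearMap.zero_apply]
  refine (congrArg (b • ·) ?_).trans (smul_zero b)
  induction f using Polynomial.induction_on' with
  | add f g hf hg => rw [map_add, TensorProduct.tmul_add, map_add, hf, hg, add_zero]
  | monomial n c =>
    have hm : (1 ⊗ₜ[K] (mk K p (monomial n c)) : TruncPoly K (l + 1) ⊗[K] TruncPoly K p)
        = (algebraMap K (TruncPoly K (l + 1)) c) • (1 ⊗ₜ gen K p) ^ n := by
      rw [Algebra.TensorProduct.tmul_pow, one_pow, algebraMap_smul, ← TensorProduct.tmul_smul,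
        mk_monomial]
    rw [hm, map_smul, hpow, smul_zero]

theorem leibniz_pow_char {B C : Type*} [CommRing B] [CommRing C] [Algebra B C]
    (hp : p.Prime) (hC : (p : C) = 0) (D : Module.End B C)
    (hD : ∀ a b, D (a * b) = D a * b + a * D b) (a b : C) :
    (D ^ p) (a * b) = (D ^ p) a * b + a * (D ^ p) b := by
  set x : Module.End B (Module.End B C) := LinearMap.mulLeft B D with hx
  set y : Module.End B (Module.End B C) := LinearMap.mulRight B D with hy
  have hc : Commute (x - y) y := by
    show (x - y) * y = y * (x - y)
    refine LinearMap.ext fun f => ?_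
    simp [hx, hy, sub_mul, mul_assoc]
  obtain ⟨r, hr⟩ := hc.exists_add_pow_prime_eq hp
  have h0 : ∀ T : Module.End B (Module.End B C), (p : Module.End B (Module.End B C)) * T = 0 := by
    intro T
    ext f c
    have : ((p : Module.End B (Module.End B C)) * T) = p • T := by simp
    rw [this]
    simp only [LinearMap.smul_apply, LinearMap.zero_apply]
    rw [nsmul_eq_mul, hC, zero_mul]
  have hr' : x ^ p = (x - y) ^ p + y ^ p := by
    have hxy : x - y + y = x := sub_add_cancel x y
    rw [hxy] at hr
    rw [hr, mul_assoc, mul_assoc, h0, add_zero]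
  have had : ∀ (n : ℕ) (a : C), ((x - y) ^ n) (LinearMap.mulLeft B a) =
      LinearMap.mulLeft B ((D ^ n) a) := by
    intro n
    induction n with
    | zero => intro a; simp
    | succ n ih =>
      intro a
      rw [pow_succ, Module.End.mul_apply]
      have : (x - y) (LinearMap.mulLeft B a) = LinearMap.mulLeft B (D a) := by
        ext c
        simp [hx, hy, hD]
      rw [this, ih, pow_succ, Module.End.mul_apply]
  have h := congrArg (fun T : Module.End B (Module.End B C) => T (LinearMap.mulLeft B a) b) hr'
  simp only [LinearMap.add_apply, had] at h
  rw [hx, hy, LinearMap.pow_mulLeft, LinearMap.pow_mulRight] at h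
  simpa using h

end

section

variable (K : Type*) [Field K] (p l : ℕ) [CharP K p]

/-- The basis element `e_i t^k` of `W_ℓ`. -/
def et (i : ℤ) (k : ℕ) : WittCurrent K p l := tmul (gen K (l + 1) ^ k) (Witt.e K p i)

/-- `W_{ℓ,(i)}`: the span of the `e_j t^k` with `-1 ≤ j ≤ p - 2`, `j ≥ i` and `0 ≤ k ≤ ℓ`. -/
def filtSubmodule (i : ℤ) : Submodule K (WittCurrent K p l) :=
  Submodule.span K
    {z | ∃ (j : ℤ) (k : ℕ), i ≤ j ∧ -1 ≤ j ∧ j ≤ (p : ℤ) - 2 ∧ k ≤ l ∧ z = et K p l j k}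

/-- The height of `χ ∈ W_ℓ^*`: the smallest `i ≥ -1` such that `χ` vanishes on `W_{ℓ,(i)}`. -/
def height (χ : Module.Dual K (WittCurrent K p l)) : ℤ :=
  sInf {i : ℤ | -1 ≤ i ∧ ∀ z ∈ filtSubmodule K p l i, χ z = 0}

/-- The linear map `a ⊗ f ↦ a ⊗ f∂` from `K[t]/(t^(ℓ+1)) ⊗ A(1)` to `W_ℓ`. -/
def ofFun : TruncPoly K (l + 1) ⊗[K] TruncPoly K p →ₗ[K] WittCurrent K p l :=
  (ofTensor K p l).toLinearMap ∘ₗ LinearMap.lTensor (TruncPoly K (l + 1))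
    ((LinearMap.toSpanSingleton (TruncPoly K p) (Witt K p) (Witt.del K p)).restrictScalars K)

/-- The `p`-map of `W_ℓ`. The Lie algebra `W_ℓ` acts faithfully on `K[t]/(t^(ℓ+1)) ⊗ A(1)`, with
image the algebra of all `K[t]/(t^(ℓ+1))`-linear derivations, and `pMap z` is the element which
acts as the `p`-th power of the operator `act z` (see `act_pMap` and `act_injective`); it is
written down here through the value of this power on the generator `1 ⊗ x`. -/
def pMap (z : WittCurrent K p l) : WittCurrent K p l :=
  ofFun K p l ((act K p l z ^ p) (1 ⊗ₜ gen K p))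

end

/-! ### Properties of the `p`-map -/

section

variable {K : Type*} [Field K] {p l : ℕ} [CharP K p]

theorem ofFun_tmul (a : TruncPoly K (l + 1)) (f : TruncPoly K p) :
    ofFun K p l (a ⊗ₜ f) = tmul a (f • Witt.del K p) := rfl

theorem natCast_eq_zero : ((p : ℕ) : TruncPoly K (l + 1) ⊗[K] TruncPoly K p) = 0 := by
  have := map_natCast (algebraMap K (TruncPoly K (l + 1) ⊗[K] TruncPoly K p)) p
  rw [← this, CharP.cast_eq_zero, map_zero]

theorem act_ofFun (f : TruncPoly K (l + 1) ⊗[K] TruncPoly K p) :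
    act K p l (ofFun K p l f) (1 ⊗ₜ[K] gen K p) = f := by
  induction f using TensorProduct.induction_on with
  | zero => simp
  | add f g hf hg => rw [map_add, map_add, LinearMap.add_apply, hf, hg]
  | tmul b f => simp [ofFun_tmul, act_tmul, Witt.del_gen]

theorem ofFun_act (z : WittCurrent K p l) :
    ofFun K p l (act K p l z (1 ⊗ₜ[K] gen K p)) = z := by
  induction z using induction_on with
  | zero => simp
  | add z w hz hw => rw [map_add, LinearMap.add_apply, map_add, hz, hw]
  | tmul a D => rw [act_tmul, ofFun_tmul, mul_one, Witt.smul_del_eq]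

/-- `W_ℓ` acts faithfully on `K[t]/(t^(ℓ+1)) ⊗ A(1)`. -/
theorem act_injective : Function.Injective (act K p l) := by
  intro z w h
  rw [← ofFun_act z, ← ofFun_act w, h]

/-- `pMap z` acts on `K[t]/(t^(ℓ+1)) ⊗ A(1)` as the `p`-th power of `z`. -/
theorem act_pMap [hp : Fact p.Prime] (z : WittCurrent K p l) :
    act K p l (pMap K p l z) = act K p l z ^ p := by
  apply derivation_ext
  · exact act_leibniz _
  · exact leibniz_pow_char hp.out natCast_eq_zero _ (act_leibniz z)
  · exact act_ofFun _

/-- `(e_i t^k)^[p] = δ_{i,0} e_i t^(kp)`. -/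
theorem pMap_et [hp : Fact p.Prime] (i : ℤ) (hi : -1 ≤ i) (k : ℕ) :
    pMap K p l (et K p l i k) = if i = 0 then et K p l i (k * p) else 0 := by
  have h2 := hp.out.two_le
  obtain ⟨q, hq⟩ : ∃ q, p = q + 2 := ⟨p - 2, by omega⟩
  rcases hi.eq_or_lt with rfl | hi
  · have h1 : (act K p l (et K p l (-1) k) ^ 2) (1 ⊗ₜ gen K p) = 0 := by
      simp [pow_two, et, Witt.e, act_tmul, Witt.del_gen]
    have h3 : (act K p l (et K p l (-1) k) ^ p) (1 ⊗ₜ gen K p) = 0 := by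
      have h4 : act K p l (et K p l (-1) k) ^ p = act K p l (et K p l (-1) k) ^ q *
          act K p l (et K p l (-1) k) ^ 2 := by
        rw [← pow_add, ← hq]
      rw [h4, Module.End.mul_apply, h1, map_zero]
    rw [pMap, h3, map_zero, if_neg (by omega)]
  · obtain ⟨j, rfl⟩ := Int.eq_ofNat_of_zero_le (a := i) (by omega)
    have hpow : ∀ n : ℕ, (act K p l (et K p l j k) ^ n) (1 ⊗ₜ gen K p) =
        (∏ m ∈ Finset.range n, ((1 + m * j : ℕ) : K)) •
          ((gen K (l + 1) ^ (k * n)) ⊗ₜ (gen K p ^ (1 + n * j))) := by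
      intro n
      induction n with
      | zero => simp
      | succ n ih =>
        rw [pow_succ', Module.End.mul_apply, ih, LinearMap.map_smul_of_tower, et, act_tmul,
          Witt.e, Derivation.smul_apply, Witt.del_gen_pow, Finset.prod_range_succ, mul_smul,
          smul_eq_mul, mul_smul_comm, TensorProduct.tmul_smul, ← pow_add, ← pow_add]
        congr 4
        · ring
        · have : ((j : ℤ) + 1).toNat = j + 1 := by omega
          rw [this, Nat.add_sub_cancel_left]
          ring
    rw [pMap, hpow, map_smul, ofFun_tmul]
    rcases Nat.eq_zero_or_pos j with rfl | hj
    · simp [et, Witt.e]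
    · have h5 : p ≤ 1 + p * j := by nlinarith
      rw [gen_pow_eq_zero K p h5, if_neg (by omega)]
      simp [tmul]

/-! ### The subalgebras `W_{ℓ,(s)}` -/

theorem pow_tmul_mem (i : ℤ) (k n : ℕ) (h : i + 1 ≤ n) :
    (tmul (gen K (l + 1) ^ k) (gen K p ^ n • Witt.del K p) : WittCurrent K p l) ∈
      filtSubmodule K p l i := by
  by_cases hk : k ≤ l
  · by_cases hn : n + 1 ≤ p
    · refine Submodule.subset_span ⟨(n : ℤ) - 1, k, by omega, by omega, by omega, hk, ?_⟩
      simp [et, Witt.e]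
    · simp [gen_pow_eq_zero K p (m := n) (by omega), tmul]
  · simp [gen_pow_eq_zero K (l + 1) (m := k) (by omega), tmul]

theorem lie_mem (i : ℕ) {z w : WittCurrent K p l} (hz : z ∈ filtSubmodule K p l i)
    (hw : w ∈ filtSubmodule K p l i) : ⁅z, w⁆ ∈ filtSubmodule K p l i := by
  induction hz using Submodule.span_induction with
  | zero => simp
  | add x y _ _ hx hy => rw [add_lie]; exact add_mem hx hy
  | smul c x _ hx => rw [smul_lie]; exact Submodule.smul_mem _ _ hx
  | mem x hx =>
    induction hw using Submodule.span_induction with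
    | zero => simp
    | add x y _ _ hx hy => rw [lie_add]; exact add_mem hx hy
    | smul c x _ hx => rw [lie_smul]; exact Submodule.smul_mem _ _ hx
    | mem y hy =>
      obtain ⟨j, k, hij, hj, -, -, rfl⟩ := hx
      obtain ⟨j', k', hij', hj', -, -, rfl⟩ := hy
      simp only [et, Witt.e, lie_tmul, Witt.lie_pow_smul_del, tmul_smul, ← pow_add]
      exact Submodule.smul_mem _ _ (pow_tmul_mem _ _ _ (by omega))

theorem pMap_mem [hp : Fact p.Prime] (i : ℕ) {z : WittCurrent K p l}
    (hz : z ∈ filtSubmodule K p l i) : pMap K p l z ∈ filtSubmodule K p l i := by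
  set J : ℕ → Submodule K (TruncPoly K (l + 1) ⊗[K] TruncPoly K p) := fun n =>
    Submodule.span K {f | ∃ k m : ℕ, n ≤ m ∧
      f = (gen K (l + 1) ^ k) ⊗ₜ[K] (gen K p ^ m)} with hJ
  have hact : ∀ n, ∀ f ∈ J n, act K p l z f ∈ J (n + i) := by
    intro n f hf
    induction hf using Submodule.span_induction with
    | zero => simp
    | add x y _ _ hx hy => rw [map_add]; exact add_mem hx hy
    | smul c x _ hx => rw [LinearMap.map_smul_of_tower]; exact Submodule.smul_mem _ _ hx
    | mem f hf =>
      obtain ⟨k, m, hm, rfl⟩ := hf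
      induction hz using Submodule.span_induction with
      | zero => simp
      | add x y _ _ hx hy => rw [map_add, LinearMap.add_apply]; exact add_mem hx hy
      | smul c x _ hx =>
        rw [map_smul, LinearMap.smul_apply]
        exact Submodule.smul_mem _ _ hx
      | mem x hx =>
        obtain ⟨j, k', hij, hj, -, -, rfl⟩ := hx
        simp only [et, Witt.e, act_tmul, Derivation.smul_apply, Witt.del_gen_pow, smul_eq_mul,
          mul_smul_comm, TensorProduct.tmul_smul, ← pow_add]
        rcases Nat.eq_zero_or_pos m with rfl | hm0
        · simp
        · exact Submodule.smul_mem _ _ (Submodule.subset_span ⟨_, _, by omega, rfl⟩)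
  have hmono : ∀ m n, n ≤ m → J m ≤ J n := by
    intro m n h
    refine Submodule.span_mono ?_
    rintro f ⟨k, m', hm, rfl⟩
    exact ⟨k, m', h.trans hm, rfl⟩
  have hpow : ∀ n : ℕ, (act K p l z ^ (n + 1)) (1 ⊗ₜ gen K p) ∈ J (1 + i) := by
    intro n
    induction n with
    | zero =>
      rw [zero_add, pow_one]
      exact hact 1 _ (Submodule.subset_span ⟨0, 1, le_rfl, by simp⟩)
    | succ n ih =>
      have h := pow_succ' (act K p l z) (n + 1)
      rw [h, Module.End.mul_apply]
      exact hmono _ _ (by omega) (hact _ _ ih)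
  have hof : ∀ f ∈ J (1 + i), ofFun K p l f ∈ filtSubmodule K p l i := by
    intro f hf
    induction hf using Submodule.span_induction with
    | zero => simp
    | add x y _ _ hx hy => rw [map_add]; exact add_mem hx hy
    | smul c x _ hx => rw [map_smul]; exact Submodule.smul_mem _ _ hx
    | mem f hf =>
      obtain ⟨k, m, hm, rfl⟩ := hf
      rw [ofFun_tmul]
      exact pow_tmul_mem _ _ _ (by omega)
  obtain ⟨n, hn⟩ : ∃ n, p = n + 1 := ⟨p - 1, by have := hp.out.pos; omega⟩
  refine hof _ ?_
  have := hpow n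
  rwa [← hn] at this

end

variable (K : Type*) [Field K] (p : ℕ) [CharP K p] (l : ℕ)

/-- `W_{ℓ,(s)}` for `s ≥ 0`, as a Lie subalgebra of `W_ℓ`. -/
def filt (s : ℕ) : LieSubalgebra K (WittCurrent K p l) :=
  { filtSubmodule K p l s with
    lie_mem' := fun hz hw => lie_mem s hz hw }

/-- `W_{ℓ,(s)}` is a restricted subalgebra. -/
theorem pMap_mem_filt [Fact p.Prime] (s : ℕ) :
    ∀ z ∈ filt K p l s, pMap K p l z ∈ filt K p l s :=
  fun _ hz => pMap_mem s hz

end WittCurrent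

/-! ## Reduced enveloping algebras and induced modules -/

section

variable {K : Type*} [Field K] {L : Type*} [LieRing L] [LieAlgebra K L]

/-- The relations `x^p - x^[p] = χ(x)^p` in the universal enveloping algebra. -/
inductive ReducedEnveloping.Rel (p : ℕ) (P : L → L) (χ : Module.Dual K L) :
    UniversalEnvelopingAlgebra K L → UniversalEnvelopingAlgebra K L → Prop
  | pow (x : L) : ReducedEnveloping.Rel p P χ
      (UniversalEnvelopingAlgebra.ι K x ^ p - UniversalEnvelopingAlgebra.ι K (P x))
      (algebraMap K _ (χ x ^ p))

/-- The reduced enveloping algebra `U_χ(L)` of a Lie algebra `L` with `p`-map `P`: the quotient of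
`U(L)` by the two-sided ideal generated by all `x^p - x^[p] - χ(x)^p`. -/
abbrev ReducedEnveloping (p : ℕ) (P : L → L) (χ : Module.Dual K L) : Type _ :=
  RingQuot (ReducedEnveloping.Rel p P χ)

namespace ReducedEnveloping

attribute [local instance 100] LieRing.ofAssociativeRing

/-- The canonical map `L → U_χ(L)`. -/
def ι (p : ℕ) (P : L → L) (χ : Module.Dual K L) (x : L) : ReducedEnveloping p P χ :=
  RingQuot.mkAlgHom K (Rel p P χ) (UniversalEnvelopingAlgebra.ι K x)

/-- The `p`-map of a restricted subalgebra. -/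
def restrictPMap (P : L → L) (H : LieSubalgebra K L) (hH : ∀ x ∈ H, P x ∈ H) (x : H) : H :=
  ⟨P x, hH x x.2⟩

/-- The algebra homomorphism `U_χ(H) → U_χ(L)` for a restricted subalgebra `H` of `L`. -/
def ofSubalgebra (p : ℕ) (P : L → L) (χ : Module.Dual K L) (H : LieSubalgebra K L)
    (hH : ∀ x ∈ H, P x ∈ H) :
    ReducedEnveloping p (restrictPMap P H hH) (χ ∘ₗ H.toSubmodule.subtype) →ₐ[K]
      ReducedEnveloping p P χ :=
  RingQuot.liftAlgHom K
    ⟨(RingQuot.mkAlgHom K (Rel p P χ)).comp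
      (UniversalEnvelopingAlgebra.lift K ((UniversalEnvelopingAlgebra.ι K).comp H.incl)), by
        rintro _ _ ⟨x⟩
        have h := RingQuot.mkAlgHom_rel K (Rel.pow (p := p) (P := P) (χ := χ) (x : L))
        simp only [map_sub, map_pow, AlgHom.commutes] at h
        simp only [AlgHom.comp_apply, map_sub, map_pow, AlgHom.commutes,
          UniversalEnvelopingAlgebra.lift_ι_apply]
        exact h⟩

theorem ofSubalgebra_ι (p : ℕ) (P : L → L) (χ : Module.Dual K L) (H : LieSubalgebra K L)
    (hH : ∀ x ∈ H, P x ∈ H) (x : H) :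
    ofSubalgebra p P χ H hH (ι p (restrictPMap P H hH) (χ ∘ₗ H.toSubmodule.subtype) x) =
      ι p P χ (x : L) := by
  simp [ofSubalgebra, ι]

end ReducedEnveloping

end

section

variable {K : Type*} [Field K] {U V : Type*} [Ring U] [Algebra K U] [Ring V] [Algebra K V]

/-- The one-dimensional `V`-module given by a character `V → K`. -/
def CharModule (_ε : V →ₐ[K] K) : Type _ := K

namespace CharModule

variable (ε : V →ₐ[K] K)

instance : AddCommGroup (CharModule ε) := inferInstanceAs (AddCommGroup K)

instance : Module K (CharModule ε) := inferInstanceAs (Module K K)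

instance : Module V (CharModule ε) := Module.compHom K ε.toRingHom

end CharModule

/-- The induced module `U ⊗_V N` of a left `V`-module `N` along `φ : V → U`: the quotient of the
left `U`-module `U ⊗_K N` by the submodule generated by all `u φ(v) ⊗ n - u ⊗ v n`. -/
abbrev InducedModule (φ : V →ₐ[K] U) (N : Type*) [AddCommGroup N] [Module K N] [Module V N] :
    Type _ :=
  (U ⊗[K] N) ⧸ Submodule.span U
    {z : U ⊗[K] N | ∃ (u : U) (v : V) (n : N), z = (u * φ v) ⊗ₜ[K] n - u ⊗ₜ[K] (v • n)}

end

namespace WittCurrent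

section

variable {K : Type*} [Field K] {p : ℕ} [CharP K p] {l : ℕ}

/-- The reduced enveloping algebra `U_χ(W_ℓ)`. -/
abbrev Uχ (χ : Module.Dual K (WittCurrent K p l)) : Type _ :=
  ReducedEnveloping p (pMap K p l) χ

variable [Fact p.Prime]

/-- The reduced enveloping algebra `U_χ(W_{ℓ,(s)})`. -/
abbrev UχFilt (χ : Module.Dual K (WittCurrent K p l)) (s : ℕ) : Type _ :=
  ReducedEnveloping p
    (ReducedEnveloping.restrictPMap (pMap K p l) (filt K p l s) (pMap_mem_filt K p l s))
    (χ ∘ₗ (filt K p l s).toSubmodule.subtype)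

/-- The canonical map `W_{ℓ,(s)} → U_χ(W_{ℓ,(s)})`. -/
abbrev ιFilt (χ : Module.Dual K (WittCurrent K p l)) (s : ℕ) (x : filt K p l s) : UχFilt χ s :=
  ReducedEnveloping.ι p
    (ReducedEnveloping.restrictPMap (pMap K p l) (filt K p l s) (pMap_mem_filt K p l s))
    (χ ∘ₗ (filt K p l s).toSubmodule.subtype) x

/-- The canonical homomorphism `U_χ(W_{ℓ,(s)}) → U_χ(W_ℓ)`. -/
abbrev inclFilt (χ : Module.Dual K (WittCurrent K p l)) (s : ℕ) : UχFilt χ s →ₐ[K] Uχ χ :=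
  ReducedEnveloping.ofSubalgebra p (pMap K p l) χ (filt K p l s) (pMap_mem_filt K p l s)

end

end WittCurrent

end

/-!
Write `m = ℓ + 1` and number the basis elements `e_i t^k` of `W_ℓ` by `q = (i + 1) m + k`. The
elements with `q ≥ n` span a restricted subalgebra `flag n`; this gives a flag from `W_ℓ = flag 0`
down to `W_{ℓ,(s)} = flag ((s + 1) m)` in steps of codimension at most one.

On `W_{ℓ,(s)}` the form `χ` vanishes on brackets, because `χ(W_{ℓ,(r)}) = 0` and `2s + 1 ≥ r`, and
the `p`-map is zero (`pMap_eq_zero`). Hence `χ` is a character of `U_χ(W_{ℓ,(s)})`, the operators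
`y - χ(y)` are nilpotent in every module, and Engel's theorem gives a common eigenvector with
eigenvalues `χ(y)` in every non-zero module (`exists_eigenvector`).

The heart of the proof is that such an eigenvector `v` in a `U_χ(W_ℓ)`-module always lies in a
submodule of dimension `p ^ (m (s + 1))` (`exists_stable_of_eigenvector`). Going up the flag from
`K v`, let `V` be the space already obtained and `x = e_i t^k` the next basis element. The dual
element `y = e_{r-1-i} t^{ℓ-k}` acts on `V` as a scalar, and `z = ⁅y, x⁆` is a non-zero multiple
of `e_{r-1} t^ℓ`, which is invertible because its `p`-th power is the scalar `χ(e_{r-1} t^ℓ) ^ p`.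
As in a Weyl algebra, `y - χ(y)` maps `x ^ (a + 1) v` to `(a + 1) x ^ a z v` up to lower powers of
`x`, so `∑ x ^ a V` with `a < p` is a direct sum (`finrank_powSpan`), and it is stable under the
larger subalgebra. The order of the flag matters: the elements `e_i t^k` with `i ≥ 0` come before
the `e_{-1} t^k`, and `W_{ℓ,(r)}` still acts by zero until the latter are reached.

It remains to see that the generator `1 ⊗ 1` of `S` is non-zero, that is, that some non-zero
module with `p`-character `χ` exists. This replaces the Poincaré–Birkhoff–Witt theorem. Given a
representation of a restricted subalgebra `H` on `M` and an element `x` with `H' = H + K x` a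
subalgebra, `H'` acts on `⨁ x ^ n ⊗ M`: the action of `H` is forced by the recursion
`y x u = x y u + ⁅y, x⁆ u`, and the Jacobi identity shows that it is a representation. The quotient by the
range of the central operator `x ^ p - x ^ [p] - χ(x) ^ p`, which raises degrees, is non-zero
(`IsReducedRep.exists_extension`). That the quotient has `p`-character `χ` on all of `H'` follows
from Jacobson's formula for `(a + b) ^ p` (`add_pow_prime_eq_jacobsonSum`).

Then `dim S = p ^ (m (s + 1))`; a non-zero submodule of `S` contains an eigenvector and so has the
same dimension; and an eigenvector in a simple module defines a non-zero map from `S` to it.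
-/

noncomputable section

open TruncPoly

/-! ### Jacobson's formula for `p`-th powers -/

/-- The coefficient of `T ^ i` in `(ad (a + T b)) ^ n (b)`. -/
def lieCoeff {L : Type*} [LieRing L] (a b : L) : ℕ → ℕ → L
  | 0, 0 => b
  | 0, _ + 1 => 0
  | n + 1, 0 => ⁅a, lieCoeff a b n 0⁆
  | n + 1, i + 1 => ⁅a, lieCoeff a b n (i + 1)⁆ + ⁅b, lieCoeff a b n i⁆

/-- The correction term of Jacobson's formula: `(a + b)^p = a^p + b^p + jacobsonSum K p a b`. The
summand with index `i` is the coefficient of `T ^ (i + 1)` in `(a + T b)^p`, whose derivative is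
`(ad (a + T b)) ^ (p - 1) (b)`. -/
def jacobsonSum (K : Type*) [Field K] (p : ℕ) {L : Type*} [LieRing L] [LieAlgebra K L]
    (a b : L) : L :=
  ∑ i ∈ Finset.range (p - 1), ((i + 1 : ℕ) : K)⁻¹ • lieCoeff a b (p - 1) i

section

variable {K : Type*} [Field K] {L : Type*} [LieRing L] [LieAlgebra K L]

theorem lieCoeff_mem (H : LieSubalgebra K L) {a b : L} (ha : a ∈ H) (hb : b ∈ H) (n i : ℕ) :
    lieCoeff a b n i ∈ H := by
  induction n generalizing i with
  | zero => cases i <;> simp [lieCoeff, hb]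
  | succ n ih =>
    cases i with
    | zero => exact H.lie_mem ha (ih 0)
    | succ i => exact add_mem (H.lie_mem ha (ih _)) (H.lie_mem hb (ih _))

theorem jacobsonSum_mem (H : LieSubalgebra K L) (p : ℕ) {a b : L} (ha : a ∈ H) (hb : b ∈ H) :
    jacobsonSum K p a b ∈ H :=
  sum_mem fun i _ => H.smul_mem _ (lieCoeff_mem H ha hb _ i)

end

/-- In characteristic `p`, `(x - y) ^ (p - 1) = ∑ x ^ i y ^ (p - 1 - i)` for commuting `x`, `y`,
because `(-1) ^ i * choose (p - 1) i ≡ 1` modulo `p`. -/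
theorem Commute.sub_pow_prime_sub_one {A : Type*} [Ring A] {p : ℕ} [hp : Fact p.Prime]
    [CharP A p] {x y : A} (h : Commute x y) :
    (x - y) ^ (p - 1) = ∑ i ∈ Finset.range p, x ^ i * y ^ (p - 1 - i) := by
  have hp1 : p - 1 + 1 = p := Nat.sub_add_cancel hp.out.one_le
  have hch : ∀ i, i < p → (((p - 1).choose i : ℕ) : A) = (-1) ^ i := by
    intro i
    induction i with
    | zero => intro _; simp
    | succ i ih =>
      intro hi
      have h1 : ((p.choose (i + 1) : ℕ) : A) = 0 := by
        rw [CharP.cast_eq_zero_iff A p]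
        exact hp.out.dvd_choose_self (Nat.succ_ne_zero i) hi
      rw [← hp1, Nat.choose_succ_succ, Nat.cast_add, ih (by omega)] at h1
      rw [pow_succ, eq_neg_of_add_eq_zero_right h1]
      simp
  have hs := (h.neg_right).add_pow (p - 1)
  rw [sub_eq_add_neg, hs, hp1]
  refine Finset.sum_congr rfl fun i hi => ?_
  have hi' : i < p := Finset.mem_range.1 hi
  have hc : (((p - 1).choose i : ℕ) : A) = (-1) ^ (p - 1 - i) := by
    rw [← Nat.choose_symm (by omega), hch _ (by omega)]
  rw [hc, neg_pow y]
  rcases neg_one_pow_eq_or A (p - 1 - i) with h1 | h1 <;> simp [h1]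

theorem charP_moduleEnd (R A : Type*) [CommRing R] [Ring A] [Algebra R A] (p : ℕ) [CharP A p] :
    CharP (Module.End R A) p := by
  refine ⟨fun n => ⟨fun h => ?_, fun h => ?_⟩⟩
  · have := congrArg (fun T : Module.End R A => T 1) h
    rw [← CharP.cast_eq_zero_iff A p]
    simpa using this
  · refine LinearMap.ext fun u => ?_
    have h0 := (CharP.cast_eq_zero_iff A p n).2 h
    simp [h0]

/-- In characteristic `p`, `(ad f) ^ (p - 1) (g) = ∑ f ^ i g f ^ (p - 1 - i)`. -/
theorem ad_pow_prime_sub_one {A : Type*} [Ring A] {p : ℕ} [hp : Fact p.Prime]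
    [CharP A p] (f g : A) :
    ((fun u => f * u - u * f)^[p - 1]) g =
      ∑ i ∈ Finset.range p, f ^ i * g * f ^ (p - 1 - i) := by
  set x : Module.End ℤ A := LinearMap.mulLeft ℤ f
  set y : Module.End ℤ A := LinearMap.mulRight ℤ f
  have hc : Commute x y := LinearMap.ext fun u => by simp [x, y, mul_assoc]
  have hch : CharP (Module.End ℤ A) p := charP_moduleEnd ℤ A p
  have h := congrArg (fun T : Module.End ℤ A => T g) (hc.sub_pow_prime_sub_one (p := p))
  have hit : ∀ n : ℕ, ((x - y) ^ n) g = ((fun u => f * u - u * f)^[n]) g := by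
    intro n
    rw [Module.End.pow_apply]
    rfl
  simp only [hit] at h
  rw [h, LinearMap.sum_apply]
  refine Finset.sum_congr rfl fun i _ => ?_
  simp [x, y, LinearMap.pow_mulLeft, LinearMap.pow_mulRight, mul_assoc]

/-- In characteristic `p`, `(ad f) ^ p = ad (f ^ p)`. -/
theorem ad_pow_prime {A : Type*} [Ring A] {p : ℕ} [hp : Fact p.Prime] [CharP A p] (f g : A) :
    ((fun u => f * u - u * f)^[p]) g = f ^ p * g - g * f ^ p := by
  set x : Module.End ℤ A := LinearMap.mulLeft ℤ f
  set y : Module.End ℤ A := LinearMap.mulRight ℤ f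
  have hc : Commute x y := LinearMap.ext fun u => by simp [x, y, mul_assoc]
  have hch : CharP (Module.End ℤ A) p := charP_moduleEnd ℤ A p
  have h := congrArg (fun T : Module.End ℤ A => T g) (sub_pow_char_of_commute _ hc)
  have hit : ((x - y) ^ p) g = ((fun u => f * u - u * f)^[p]) g := by
    rw [Module.End.pow_apply]
    rfl
  rw [← hit, h]
  simp [x, y, LinearMap.pow_mulLeft, LinearMap.pow_mulRight]

theorem Polynomial.derivative_pow_noncomm {A : Type*} [Ring A] (f : A[X]) (n : ℕ) :
    derivative (f ^ n) = ∑ i ∈ Finset.range n, f ^ i * derivative f * f ^ (n - 1 - i) := by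
  induction n with
  | zero => simp
  | succ n ih =>
    rw [pow_succ, derivative_mul, ih, Finset.sum_range_succ, Finset.sum_mul]
    simp only [Nat.add_sub_cancel, Nat.sub_self, pow_zero, mul_one]
    congr 1
    refine Finset.sum_congr rfl fun i hi => ?_
    have : n - i = n - 1 - i + 1 := by have := Finset.mem_range.1 hi; omega
    simp only [this, pow_succ, mul_assoc]

/-- Jacobson's formula for the images of two elements of a subalgebra under a linear map which is
multiplicative for the bracket there. The coefficients of `(a + T b) ^ p` are read off from its
derivative in `T`, which is `(ad (a + T b)) ^ (p - 1) (b)`. -/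
theorem add_pow_prime_eq_jacobsonSum {K : Type*} [Field K] {L : Type*} [LieRing L] [LieAlgebra K L]
    {A : Type*} [Ring A] [Algebra K A] [Nontrivial A] {p : ℕ} [hp : Fact p.Prime] [CharP K p]
    (H : LieSubalgebra K L) (ρ : L →ₗ[K] A)
    (hρ : ∀ a ∈ H, ∀ b ∈ H, ρ ⁅a, b⁆ = ρ a * ρ b - ρ b * ρ a) {a b : L} (ha : a ∈ H) (hb : b ∈ H) :
    (ρ a + ρ b) ^ p = ρ a ^ p + ρ b ^ p + ρ (jacobsonSum K p a b) := by
  have : CharP A p := charP_of_injective_algebraMap (algebraMap K A).injective p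
  have : CharP A[X] p := charP_of_injective_ringHom (C_injective (R := A)) p
  set f : A[X] := C (ρ a) + C (ρ b) * X with hf
  have hcoef : ∀ n i, (((fun u => f * u - u * f)^[n]) (C (ρ b))).coeff i =
      ρ (lieCoeff a b n i) := by
    intro n
    induction n with
    | zero => intro i; cases i <;> simp [lieCoeff, coeff_C]
    | succ n ih =>
      intro i
      rw [Function.iterate_succ_apply']
      revert ih
      generalize (fun u => f * u - u * f)^[n] (C (ρ b)) = g
      intro ih
      rw [coeff_sub, hf, add_mul, mul_add, mul_assoc, X_mul, ← mul_assoc]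
      cases i with
      | zero =>
        simp [lieCoeff, ih, hρ a ha _ (lieCoeff_mem H ha hb _ _), mul_coeff_zero]
      | succ i =>
        rw [← mul_assoc]
        simp only [coeff_add, coeff_C_mul, coeff_mul_C, coeff_mul_X, ih, lieCoeff, map_add,
          hρ a ha _ (lieCoeff_mem H ha hb _ _), hρ b hb _ (lieCoeff_mem H ha hb _ _)]
        abel
  have hder : derivative (f ^ p) = ((fun u => f * u - u * f)^[p - 1]) (C (ρ b)) := by
    rw [Polynomial.derivative_pow_noncomm, ad_pow_prime_sub_one]
    simp [hf]
  have hmid : ∀ i ∈ Finset.range (p - 1), (f ^ p).coeff (i + 1) =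
      ρ (((i + 1 : ℕ) : K)⁻¹ • lieCoeff a b (p - 1) i) := by
    intro i hi
    have hi' := Finset.mem_range.1 hi
    have h0 : ((i + 1 : ℕ) : K) ≠ 0 := by
      rw [Ne, CharP.cast_eq_zero_iff K p]
      intro hd
      have := Nat.le_of_dvd (Nat.succ_pos i) hd
      omega
    have h1 : (derivative (f ^ p)).coeff i = ρ (lieCoeff a b (p - 1) i) := by rw [hder, hcoef]
    rw [coeff_derivative] at h1
    rw [map_smul, ← h1, eq_inv_smul_iff₀ h0, Nat.cast_smul_eq_nsmul, nsmul_eq_mul]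
    have := Nat.cast_commute (i + 1) ((f ^ p).coeff (i + 1))
    rw [this.eq]
    push_cast
    rfl
  have hdeg : f.natDegree ≤ 1 := by
    rw [hf]
    compute_degree
  have hzero : (f ^ p).coeff 0 = ρ a ^ p := by
    have h2 : ∀ n : ℕ, (f ^ n).coeff 0 = ρ a ^ n := by
      intro n
      induction n with
      | zero => simp
      | succ n ih => rw [pow_succ, mul_coeff_zero, ih, pow_succ]; simp [hf]
    exact h2 p
  have htop : (f ^ p).coeff p = ρ b ^ p := by
    have := coeff_pow_of_natDegree_le (n := 1) (m := p) hdeg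
    simpa [hf] using this
  have heval : (f ^ p).eval 1 = (ρ a + ρ b) ^ p := by
    have h3 : ∀ g : A[X], g.eval 1 =
        eval₂RingHom' (RingHom.id A) 1 (fun _ => Commute.one_right _) g := fun g => rfl
    rw [h3, map_pow, ← h3]
    simp [hf]
  have hp1 : p = p - 1 + 1 := (Nat.sub_add_cancel hp.out.one_le).symm
  have hdegp : (f ^ p).natDegree < p + 1 := by
    have := natDegree_pow_le (p := f) (n := p)
    nlinarith
  rw [← heval, eval_eq_sum_range' hdegp, Finset.sum_range_succ, htop]
  simp only [one_pow, mul_one]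
  have hsum : ∑ i ∈ Finset.range p, (f ^ p).coeff i =
      (∑ i ∈ Finset.range (p - 1), (f ^ p).coeff (i + 1)) + (f ^ p).coeff 0 := by
    conv_lhs => rw [hp1]
    rw [Finset.sum_range_succ', ← hp1]
  rw [hsum, hzero, Finset.sum_congr rfl hmid, jacobsonSum, map_sum]
  abel

/-! ### Restricted Lie algebras and their representations with a given `p`-character -/

/-- The axioms of a `p`-map on a Lie algebra over a field of characteristic `p`. -/
structure IsPMap (K : Type*) [Field K] (p : ℕ) {L : Type*} [LieRing L] [LieAlgebra K L]
    (P : L → L) : Prop where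
  smul : ∀ (c : K) (a : L), P (c • a) = c ^ p • P a
  add : ∀ a b : L, P (a + b) = P a + P b + jacobsonSum K p a b
  ad_pow : ∀ a b : L, ((fun u => ⁅a, u⁆)^[p]) b = ⁅P a, b⁆

/-- `ρ` restricts to a representation of the Lie subalgebra `H` with `p`-character `χ`. The map `ρ`
is defined on the whole of `L`, but nothing is required of its values outside `H`. -/
structure IsReducedRep {K : Type*} [Field K] (p : ℕ) {L : Type*} [LieRing L] [LieAlgebra K L]
    (P : L → L) (χ : Module.Dual K L) (H : LieSubalgebra K L)
    {M : Type*} [AddCommGroup M] [Module K M] (ρ : L →ₗ[K] Module.End K M) : Prop where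
  lie : ∀ a ∈ H, ∀ b ∈ H, ρ ⁅a, b⁆ = ρ a * ρ b - ρ b * ρ a
  pow : ∀ a ∈ H, ρ a ^ p = ρ (P a) + algebraMap K (Module.End K M) (χ a ^ p)

section

variable {K : Type*} [Field K] {p : ℕ} {L : Type*} [LieRing L] [LieAlgebra K L]
  {P : L → L} {χ : Module.Dual K L} {H H' : LieSubalgebra K L} {x : L}
  {M : Type*} [AddCommGroup M] [Module K M] {ρ : L →ₗ[K] Module.End K M}

theorem lie_iterate_mem {a b : L} (ha : a ∈ H) (hb : b ∈ H) (n : ℕ) :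
    ((fun u => ⁅a, u⁆)^[n]) b ∈ H := by
  induction n with
  | zero => exact hb
  | succ n ih => rw [Function.iterate_succ_apply']; exact H.lie_mem ha ih

/-- The `p`-map preserves a subalgebra generated, as a vector space, by a restricted subalgebra
and one more element with `p`-th power in it. -/
theorem IsPMap.mem_of_forall_eq_add_smul (hP : IsPMap K p P) (hle : H ≤ H') (hx : x ∈ H')
    (hsup : ∀ z ∈ H', ∃ y ∈ H, ∃ c : K, z = y + c • x)
    (hPH : ∀ a ∈ H, P a ∈ H) (hPx : P x ∈ H') : ∀ a ∈ H', P a ∈ H' := by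
  intro z hz
  obtain ⟨y, hy, c, rfl⟩ := hsup z hz
  rw [hP.add, hP.smul]
  exact add_mem (add_mem (hle (hPH y hy)) (H'.smul_mem _ hPx))
    (jacobsonSum_mem H' p (hle hy) (H'.smul_mem _ hx))

variable [Fact p.Prime] [CharP K p]

/-- By Jacobson's formula `a ↦ a ^ p - a ^ [p]` is semilinear, so that the `p`-character has to be
checked on generators only. -/
theorem IsReducedRep.of_forall_eq_add_smul [Nontrivial M] (hP : IsPMap K p P) (hle : H ≤ H')
    (hx : x ∈ H') (hsup : ∀ z ∈ H', ∃ y ∈ H, ∃ c : K, z = y + c • x)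
    (hlie : ∀ a ∈ H', ∀ b ∈ H', ρ ⁅a, b⁆ = ρ a * ρ b - ρ b * ρ a)
    (hpow : ∀ a ∈ H, ρ a ^ p = ρ (P a) + algebraMap K (Module.End K M) (χ a ^ p))
    (hpx : ρ x ^ p = ρ (P x) + algebraMap K (Module.End K M) (χ x ^ p)) :
    IsReducedRep p P χ H' ρ := by
  refine ⟨hlie, fun z hz => ?_⟩
  obtain ⟨y, hy, c, rfl⟩ := hsup z hz
  have hadd : (χ y + c * χ x) ^ p = χ y ^ p + c ^ p * χ x ^ p := by
    rw [add_pow_char, mul_pow]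
  rw [map_add, add_pow_prime_eq_jacobsonSum H' ρ hlie (hle hy) (H'.smul_mem c hx), hpow y hy,
    map_smul, _root_.smul_pow, hpx, hP.add, hP.smul, map_add, map_add, map_smul, map_add, map_smul,
    smul_eq_mul, hadd, map_add, smul_add, map_mul, ← Algebra.smul_def]
  abel

/-- The elements `a ^ p - a ^ [p]` are central, because `(ad a) ^ p = ad (a ^ [p])`. -/
theorem commute_pow_sub_pMap (hP : IsPMap K p P) (hPH : ∀ a ∈ H, P a ∈ H) [Nontrivial M]
    (hlie : ∀ a ∈ H, ∀ b ∈ H, ρ ⁅a, b⁆ = ρ a * ρ b - ρ b * ρ a) {a b : L} (ha : a ∈ H)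
    (hb : b ∈ H) : Commute (ρ a ^ p - ρ (P a)) (ρ b) := by
  have : CharP (Module.End K M) p :=
    charP_of_injective_algebraMap (algebraMap K (Module.End K M)).injective p
  have hit : ∀ n : ℕ, ρ (((fun u => ⁅a, u⁆)^[n]) b) =
      ((fun u => ρ a * u - u * ρ a)^[n]) (ρ b) := by
    intro n
    induction n with
    | zero => rfl
    | succ n ih =>
      rw [Function.iterate_succ_apply', Function.iterate_succ_apply', ← ih,
        hlie a ha _ (lie_iterate_mem ha hb n)]
  have h := hit p
  rw [ad_pow_prime, hP.ad_pow, hlie _ (hPH a ha) b hb] at h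
  rw [Commute, SemiconjBy, sub_mul, mul_sub, sub_eq_sub_iff_sub_eq_sub, ← h]

end

/-! ### Extending a representation to a larger subalgebra -/

namespace InducedRep

variable {K : Type*} [Field K] {L : Type*} [LieRing L] [LieAlgebra K L]
  {M : Type*} [AddCommGroup M] [Module K M]

/-- The shift `x ^ n ⊗ m ↦ x ^ (n + 1) ⊗ m`, where `ℕ →₀ M` stands for `⨁ x ^ n ⊗ M`. -/
def shift (K M : Type*) [Field K] [AddCommGroup M] [Module K M] : Module.End K (ℕ →₀ M) :=
  Finsupp.lmapDomain M K Nat.succ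

theorem shift_single (n : ℕ) (m : M) :
    shift K M (Finsupp.single n m) = Finsupp.single (n + 1) m := by
  simp [shift]

/-- For `y ∈ H` this is the `H`-component of `⁅y, x⁆`; here `φ` is the linear form with kernel `H`
and value `1` at `x`. -/
def delta (φ : Module.Dual K L) (x : L) : L →ₗ[K] L where
  toFun y := ⁅y, x⁆ - φ ⁅y, x⁆ • x
  map_add' a b := by simp only [add_lie, map_add, add_smul]; abel
  map_smul' c a := by
    simp only [smul_lie, map_smul, smul_eq_mul, mul_smul, smul_sub, RingHom.id_apply]

/-- The `x`-component of `⁅y, x⁆`, as a function of `y`. -/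
def lam (φ : Module.Dual K L) (x : L) : Module.Dual K L where
  toFun y := φ ⁅y, x⁆
  map_add' a b := by simp only [add_lie, map_add]
  map_smul' c a := by simp only [smul_lie, map_smul, RingHom.id_apply]

/-- The map `y, m ↦ y (x ^ n ⊗ m)` for `y ∈ H`, from the recursion
`y (x ^ (n + 1) ⊗ m) = x y (x ^ n ⊗ m) + ⁅y, x⁆ (x ^ n ⊗ m)`. -/
def action (ρ : L →ₗ[K] Module.End K M) (φ : Module.Dual K L) (x : L) :
    ℕ → L →ₗ[K] M →ₗ[K] (ℕ →₀ M)
  | 0 => LinearMap.compRight K (Finsupp.lsingle 0) ∘ₗ ρ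
  | n + 1 => LinearMap.compRight K (shift K M) ∘ₗ action ρ φ x n +
      action ρ φ x n ∘ₗ delta φ x + (lam φ x).smulRight (Finsupp.lsingle (n + 1))

/-- The action of `H` on `⨁ x ^ n ⊗ M`. -/
def subRep (ρ : L →ₗ[K] Module.End K M) (φ : Module.Dual K L) (x : L) :
    L →ₗ[K] Module.End K (ℕ →₀ M) :=
  (Finsupp.lsum K).toLinearMap ∘ₗ LinearMap.pi (action ρ φ x)

/-- The action of `H + K x` on `⨁ x ^ n ⊗ M`, the analogue of induction from `H`; the element `x`
acts as the shift. -/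
def rep (ρ : L →ₗ[K] Module.End K M) (φ : Module.Dual K L) (x : L) :
    L →ₗ[K] Module.End K (ℕ →₀ M) :=
  subRep ρ φ x ∘ₗ (LinearMap.id - φ.smulRight x) + φ.smulRight (shift K M)

variable (ρ : L →ₗ[K] Module.End K M) (φ : Module.Dual K L) (x : L)

theorem subRep_single (y : L) (n : ℕ) (m : M) :
    subRep ρ φ x y (Finsupp.single n m) = action ρ φ x n y m := by
  simp [subRep]

theorem rep_apply (z : L) :
    rep ρ φ x z = subRep ρ φ x (z - φ z • x) + φ z • shift K M := rfl

theorem rep_of_eq_zero {y : L} (hy : φ y = 0) : rep ρ φ x y = subRep ρ φ x y := by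
  simp [rep_apply, hy]

theorem rep_self (hx : φ x = 1) : rep ρ φ x x = shift K M := by
  simp [rep_apply, hx]

theorem rep_zero_single {y : L} (hy : φ y = 0) (m : M) :
    rep ρ φ x y (Finsupp.single 0 m) = Finsupp.single 0 (ρ y m) := by
  rw [rep_of_eq_zero ρ φ x hy, subRep_single]
  rfl

theorem rep_shift {y : L} (hy : φ y = 0) (u : ℕ →₀ M) :
    rep ρ φ x y (shift K M u) = shift K M (rep ρ φ x y u) + rep ρ φ x ⁅y, x⁆ u := by
  rw [rep_of_eq_zero ρ φ x hy]
  induction u using Finsupp.induction_linear with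
  | zero => simp
  | add u v hu hv => simp only [map_add, hu, hv]; abel
  | single n m =>
    rw [shift_single, subRep_single, subRep_single, rep_apply, LinearMap.add_apply,
      LinearMap.smul_apply, shift_single, subRep_single, ← add_assoc]
    rfl

section Lie

variable {ρ φ x} {H H' : LieSubalgebra K L} (hle : H ≤ H') (hx : x ∈ H') (hφx : φ x = 1)
  (hφH : ∀ y ∈ H, φ y = 0) (hsup : ∀ z ∈ H', ∃ y ∈ H, ∃ c : K, z = y + c • x)
  (hlie : ∀ a ∈ H, ∀ b ∈ H, ρ ⁅a, b⁆ = ρ a * ρ b - ρ b * ρ a)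

include hle hx hφx hφH hsup hlie

/-- The bracket relation for `a, b ∈ H`, by induction on the degree in `x`: commuting `⁅a, b⁆` past
one factor `x` produces the two terms of the Jacobi identity for `⁅⁅a, b⁆, x⁆`. -/
theorem rep_lie_of_mem {a : L} (ha : a ∈ H) {b : L} (hb : b ∈ H) (u : ℕ →₀ M) :
    rep ρ φ x ⁅a, b⁆ u = rep ρ φ x a (rep ρ φ x b u) - rep ρ φ x b (rep ρ φ x a u) := by
  induction u using Finsupp.induction_linear with
  | zero => simp
  | add u v hu hv => simp only [map_add, hu, hv]; abel
  | single n m =>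
    induction n generalizing a b with
    | zero =>
      rw [rep_zero_single _ _ _ (hφH _ (H.lie_mem ha hb)), rep_zero_single _ _ _ (hφH _ ha),
        rep_zero_single _ _ _ (hφH _ hb), rep_zero_single _ _ _ (hφH _ ha),
        rep_zero_single _ _ _ (hφH _ hb), hlie a ha b hb, ← Finsupp.single_sub]
      rfl
    | succ n ih =>
      have key : ∀ c ∈ H, ∀ z ∈ H', rep ρ φ x ⁅c, z⁆ (Finsupp.single n m) =
          rep ρ φ x c (rep ρ φ x z (Finsupp.single n m)) -
            rep ρ φ x z (rep ρ φ x c (Finsupp.single n m)) := by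
        intro c hc z hz
        obtain ⟨y, hy, t, rfl⟩ := hsup z hz
        simp only [lie_add, lie_smul, map_add, map_smul, LinearMap.add_apply,
          LinearMap.smul_apply, ih hc hy, rep_self ρ φ x hφx, rep_shift ρ φ x (hφH c hc),
          smul_add]
        abel
      have hj : ⁅⁅a, b⁆, x⁆ = ⁅a, ⁅b, x⁆⁆ - ⁅b, ⁅a, x⁆⁆ := lie_lie a b x
      rw [← shift_single (K := K), rep_shift _ _ _ (hφH _ (H.lie_mem ha hb)),
        rep_shift _ _ _ (hφH _ ha), rep_shift _ _ _ (hφH _ hb), map_add, map_add,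
        rep_shift _ _ _ (hφH _ ha),
        rep_shift _ _ _ (hφH _ hb), ih ha hb, hj, map_sub, map_sub, LinearMap.sub_apply,
        key a ha _ (H'.lie_mem (hle hb) hx), key b hb _ (H'.lie_mem (hle ha) hx)]
      abel

theorem rep_lie {a : L} (ha : a ∈ H') {b : L} (hb : b ∈ H') :
    rep ρ φ x ⁅a, b⁆ = rep ρ φ x a * rep ρ φ x b - rep ρ φ x b * rep ρ φ x a := by
  obtain ⟨a, ha', s, rfl⟩ := hsup a ha
  obtain ⟨b, hb', t, rfl⟩ := hsup b hb
  refine LinearMap.ext fun u => ?_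
  simp only [add_lie, smul_lie, lie_add, lie_smul, lie_self, ← lie_skew x b, map_add, map_smul,
    map_neg, map_zero, LinearMap.add_apply, LinearMap.smul_apply, LinearMap.neg_apply,
    LinearMap.zero_apply, LinearMap.sub_apply,
    Module.End.mul_apply, rep_self ρ φ x hφx, rep_shift ρ φ x (hφH _ ha'),
    rep_shift ρ φ x (hφH _ hb'), rep_lie_of_mem hle hx hφx hφH hsup hlie ha' hb', smul_add,
    smul_neg, smul_zero, smul_smul, mul_comm s t]
  abel

end Lie

/-- The action of `H` does not raise degrees. -/
theorem action_mem (n : ℕ) (y : L) (m : M) :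
    action ρ φ x n y m ∈ Finsupp.supported M K (Set.Iio (n + 1)) := by
  induction n generalizing y with
  | zero => exact Finsupp.single_mem_supported K _ (by simp)
  | succ n ih =>
    refine add_mem (add_mem ?_ ?_) ?_
    · have : ∀ v ∈ Finsupp.supported M K (Set.Iio (n + 1)),
          shift K M v ∈ Finsupp.supported M K (Set.Iio (n + 1 + 1)) := by
        intro v hv
        refine Finsupp.supported_mono (α := ℕ) ?_
          (Finsupp.lmapDomain_supported M K Nat.succ (Set.Iio (n + 1)) ▸
            Submodule.mem_map_of_mem hv)
        rintro _ ⟨k, hk, rfl⟩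
        simpa using hk
      exact this _ (ih y)
    · exact Finsupp.supported_mono (Set.Iio_subset_Iio (by omega)) (ih _)
    · exact Submodule.smul_mem _ _ (Finsupp.single_mem_supported K _ (by simp))

theorem subRep_mem (n : ℕ) (y : L) {u : ℕ →₀ M} (hu : u ∈ Finsupp.supported M K (Set.Iio n)) :
    subRep ρ φ x y u ∈ Finsupp.supported M K (Set.Iio n) := by
  have : subRep ρ φ x y u = u.sum fun k m => action ρ φ x k y m := by
    simp [subRep, Finsupp.lsum_apply]
  rw [this]
  refine sum_mem fun k hk => ?_
  have hk' : k < n := (Finsupp.mem_supported K u).1 hu hk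
  exact Finsupp.supported_mono (Set.Iio_subset_Iio (by omega)) (action_mem ρ φ x k y _)

theorem shift_apply_succ (u : ℕ →₀ M) (k : ℕ) : shift K M u (k + 1) = u k := by
  rw [shift, Finsupp.lmapDomain_apply]
  exact Finsupp.mapDomain_apply Nat.succ_injective u k

theorem shift_pow_apply_add (p : ℕ) (u : ℕ →₀ M) (k : ℕ) :
    (shift K M ^ p) u (k + p) = u k := by
  induction p generalizing u with
  | zero => simp
  | succ p ih => rw [pow_succ', Module.End.mul_apply, ← add_assoc, shift_apply_succ, ih]

/-- The operator `x ^ p - z - c` strictly raises degrees, for any `z` in `H + K x` and any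
scalar `c`, hence `1 ⊗ m` is not in its range. -/
theorem single_zero_notMem_range {p : ℕ} (hp : 2 ≤ p) (z : L) (c : K) {m : M} (hm : m ≠ 0) :
    Finsupp.single 0 m ∉ LinearMap.range
      (shift K M ^ p - rep ρ φ x z - algebraMap K (Module.End K (ℕ →₀ M)) c) := by
  rintro ⟨u, hu⟩
  have hu0 : u ≠ 0 := by
    rintro rfl
    rw [map_zero, eq_comm, Finsupp.single_eq_zero] at hu
    exact hm hu
  set d := u.support.max' (Finsupp.support_nonempty_iff.2 hu0)
  have hd : u d ≠ 0 := Finsupp.mem_support_iff.1 (Finset.max'_mem _ _)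
  have hsupp : u ∈ Finsupp.supported M K (Set.Iio (d + 1)) := by
    rw [Finsupp.mem_supported]
    intro k hk
    exact Nat.lt_succ_of_le (Finset.le_max' _ _ hk)
  have hvan : ∀ {n : ℕ} {v : ℕ →₀ M}, v ∈ Finsupp.supported M K (Set.Iio n) →
      ∀ k, n ≤ k → v k = 0 := fun hv k hk =>
    Finsupp.notMem_support_iff.1 fun h =>
      absurd ((Finsupp.mem_supported K _).1 hv h) (by simpa using hk)
  obtain ⟨q, rfl⟩ : ∃ q, p = q + 2 := ⟨p - 2, by omega⟩
  have h := DFunLike.congr_fun hu (d + (q + 2))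
  rw [LinearMap.sub_apply, LinearMap.sub_apply, rep_apply, LinearMap.add_apply,
    LinearMap.smul_apply, Module.algebraMap_end_apply, Finsupp.sub_apply, Finsupp.sub_apply,
    Finsupp.add_apply, Finsupp.smul_apply, Finsupp.smul_apply, shift_pow_apply_add,
    hvan (subRep_mem ρ φ x _ _ hsupp) _ (by omega), ← add_assoc, shift_apply_succ,
    hvan hsupp (d + q + 1) (by omega), hvan hsupp (d + q + 1 + 1) (by omega)] at h
  simp [hd] at h

end InducedRep

open InducedRep in
/-- A representation of a restricted subalgebra `H` with `p`-character `χ` on a non-zero space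
gives one of any restricted subalgebra in which `H` has codimension one: the quotient of the
induced representation by the range of the central operator `x ^ p - x ^ [p] - χ(x) ^ p`. -/
theorem IsReducedRep.exists_extension {K : Type*} [Field K] {p : ℕ} [hp : Fact p.Prime] [CharP K p]
    {L : Type*} [LieRing L] [LieAlgebra K L] {P : L → L} (hP : IsPMap K p P)
    {χ : Module.Dual K L} {H H' : LieSubalgebra K L} {x : L} (hle : H ≤ H') (hx : x ∈ H')
    (hxH : x ∉ H) (hsup : ∀ z ∈ H', ∃ y ∈ H, ∃ c : K, z = y + c • x)
    (hPH : ∀ a ∈ H, P a ∈ H) (hPx : P x ∈ H')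
    {M : Type*} [AddCommGroup M] [Module K M] [Nontrivial M] {ρ : L →ₗ[K] Module.End K M}
    (hρ : IsReducedRep p P χ H ρ) :
    ∃ (R : Submodule K (ℕ →₀ M)) (ρ' : L →ₗ[K] Module.End K ((ℕ →₀ M) ⧸ R)),
      Nontrivial ((ℕ →₀ M) ⧸ R) ∧ IsReducedRep p P χ H' ρ' := by
  have hPH' := hP.mem_of_forall_eq_add_smul hle hx hsup hPH hPx
  obtain ⟨φ, hφH, hφx⟩ := LinearMap.exists_extend_of_notMem (p := H.toSubmodule)
    (0 : H.toSubmodule →ₗ[K] K) hxH 1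
  replace hφH : ∀ y ∈ H, φ y = 0 := fun y hy => LinearMap.congr_fun hφH ⟨y, hy⟩
  have hlie : ∀ a ∈ H', ∀ b ∈ H', _ := fun a ha b hb =>
    rep_lie (M := M) hle hx hφx hφH hsup hρ.lie ha hb
  set c : Module.End K (ℕ →₀ M) := algebraMap K _ (χ x ^ p) with hc
  set Z : Module.End K (ℕ →₀ M) := rep ρ φ x x ^ p - rep ρ φ x (P x) - c with hZ
  have hcomm : ∀ b ∈ H', Commute Z (rep ρ φ x b) := fun b hb =>
    (commute_pow_sub_pMap hP hPH' hlie hx hb).sub_left (Algebra.commute_algebraMap_left _ _)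
  -- on `H` the `p`-character is the one on `M`, as `a ^ p - a ^ [p]` commutes with `x`
  have hpowH : ∀ a ∈ H, rep ρ φ x a ^ p = rep ρ φ x (P a) + algebraMap K _ (χ a ^ p) := by
    intro a ha
    have hca := (commute_pow_sub_pMap hP hPH' hlie (hle ha) hx).eq
    rw [rep_self ρ φ x hφx] at hca
    rw [← sub_eq_iff_eq_add']
    refine Finsupp.lhom_ext fun n m => ?_
    induction n with
    | zero =>
      have hit : ∀ k : ℕ, (rep ρ φ x a ^ k) (Finsupp.single 0 m) =
          Finsupp.single 0 ((ρ a ^ k) m) := by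
        intro k
        induction k with
        | zero => simp
        | succ k ih =>
          rw [pow_succ', Module.End.mul_apply, ih, rep_zero_single _ _ _ (hφH a ha), pow_succ',
            Module.End.mul_apply]
      rw [LinearMap.sub_apply, hit, rep_zero_single _ _ _ (hφH _ (hPH a ha)), hρ.pow a ha]
      simp [-map_pow, Module.algebraMap_end_apply]
    | succ n ih =>
      have h := LinearMap.congr_fun hca (Finsupp.single n m)
      rw [Module.End.mul_apply, Module.End.mul_apply, ih, shift_single] at h
      rw [h]
      simp [-map_pow, shift_single, Module.algebraMap_end_apply]
  set R := LinearMap.range Z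
  have hR : ∀ a ∈ H', R ≤ R.comap (rep ρ φ x a) := by
    rintro a ha _ ⟨u, rfl⟩
    exact ⟨rep ρ φ x a u, LinearMap.congr_fun (hcomm a ha).eq u⟩
  -- the action on the quotient, extended from `H'` to `L` arbitrarily
  obtain ⟨ρ', hρ'⟩ := LinearMap.exists_extend (p := H'.toSubmodule)
    ({ toFun := fun a => R.mapQ R (rep ρ φ x a) (hR a a.2)
       map_add' := fun a b => by
        refine Submodule.linearMap_qext _ (LinearMap.ext fun u => ?_)
        simp
       map_smul' := fun t a => by
        refine Submodule.linearMap_qext _ (LinearMap.ext fun u => ?_)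
        simp } : H'.toSubmodule →ₗ[K] Module.End K ((ℕ →₀ M) ⧸ R))
  replace hρ' : ∀ a (ha : a ∈ H') u, ρ' a (R.mkQ u) = R.mkQ (rep ρ φ x a u) := by
    intro a ha u
    have := LinearMap.congr_fun hρ' ⟨a, ha⟩
    simp only [LinearMap.comp_apply, Submodule.subtype_apply] at this
    rw [this]
    rfl
  have hit : ∀ a ∈ H', ∀ (k : ℕ) u, (ρ' a ^ k) (R.mkQ u) = R.mkQ ((rep ρ φ x a ^ k) u) := by
    intro a ha k u
    induction k with
    | zero => rfl
    | succ k ih =>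
      rw [pow_succ', Module.End.mul_apply, ih, hρ' a ha, pow_succ', Module.End.mul_apply]
  have hnt : Nontrivial ((ℕ →₀ M) ⧸ R) := by
    rw [Submodule.Quotient.nontrivial_iff]
    obtain ⟨m, hm⟩ := exists_ne (0 : M)
    have h := single_zero_notMem_range ρ φ x hp.out.two_le (P x) (χ x ^ p) hm
    rw [← rep_self ρ φ x hφx] at h
    exact fun htop => h (htop ▸ Submodule.mem_top : Finsupp.single 0 m ∈ R)
  refine ⟨R, ρ', hnt, .of_forall_eq_add_smul hP hle hx hsup ?_ ?_ ?_⟩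
  · intro a ha b hb
    refine Submodule.linearMap_qext _ (LinearMap.ext fun u => ?_)
    simp only [LinearMap.comp_apply, LinearMap.sub_apply, Module.End.mul_apply,
      hρ' _ (H'.lie_mem ha hb), hρ' a ha, hρ' b hb, hlie a ha b hb, map_sub]
  · intro a ha
    refine Submodule.linearMap_qext _ (LinearMap.ext fun u => ?_)
    simp only [LinearMap.comp_apply, LinearMap.add_apply, hit a (hle ha), hpowH a ha,
      hρ' _ (hle (hPH a ha)), map_add, Module.algebraMap_end_apply, map_smul]
  · refine Submodule.linearMap_qext _ (LinearMap.ext fun u => ?_)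
    have h0 : R.mkQ (Z u) = 0 := (Submodule.Quotient.mk_eq_zero R).2 ⟨u, rfl⟩
    simp only [hZ, hc, LinearMap.sub_apply, map_sub, Module.algebraMap_end_apply,
      map_smul, sub_eq_iff_eq_add', add_zero] at h0
    simp only [LinearMap.comp_apply, LinearMap.add_apply, hit x hx, hρ' _ hPx, h0,
      Module.algebraMap_end_apply]

/-! ### Common eigenvectors -/

/-- Engel's theorem for a representation shifted by a character. -/
theorem exists_common_eigenvector {K : Type*} [Field K] {L : Type*} [LieRing L] [LieAlgebra K L]
    [Module.Finite K L] {M : Type*} [AddCommGroup M] [Module K M] [Nontrivial M]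
    (θ : Module.Dual K L) (ρ : L →ₗ[K] Module.End K M)
    (hlie : ∀ a b : L, ρ ⁅a, b⁆ = ρ a * ρ b - ρ b * ρ a) (hθ : ∀ a b : L, θ ⁅a, b⁆ = 0)
    (hnil : ∀ a, IsNilpotent (ρ a - algebraMap K (Module.End K M) (θ a))) :
    ∃ v : M, v ≠ 0 ∧ ∀ a, ρ a v = θ a • v := by
  let _ : LieRingModule L M :=
    { bracket := fun a m => ρ a m - θ a • m
      add_lie := fun a b m => by
        simp only [map_add, LinearMap.add_apply, add_smul]; abel
      lie_add := fun a m n => by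
        simp only [map_add, smul_add]; abel
      leibniz_lie := fun a b m => by
        change ρ a (ρ b m - θ b • m) - θ a • (ρ b m - θ b • m) =
          (ρ ⁅a, b⁆ m - θ ⁅a, b⁆ • m) + (ρ b (ρ a m - θ a • m) - θ b • (ρ a m - θ a • m))
        simp only [hlie, hθ, LinearMap.sub_apply, Module.End.mul_apply, map_sub, map_smul,
          smul_sub, smul_smul, mul_comm (θ a), zero_smul]
        abel }
  have hbr : ∀ (a : L) (m : M), ⁅a, m⁆ = ρ a m - θ a • m := fun _ _ => rfl
  let _ : LieModule K L M :=
    { smul_lie := fun t a m => by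
        simp only [hbr, map_smul, LinearMap.smul_apply, smul_sub, smul_eq_mul, mul_smul]
      lie_smul := fun t a m => by
        simp only [hbr, map_smul, smul_sub, smul_comm t] }
  have hend : ∀ a, LieModule.toEnd K L M a = ρ a - algebraMap K (Module.End K M) (θ a) := fun a =>
    LinearMap.ext fun m => by simp [hbr, Module.algebraMap_end_apply]
  have hN : LieModule.IsNilpotent L M :=
    LieAlgebra.isEngelian_of_isNoetherian (R := K) (L := L) M fun a => by rw [hend]; exact hnil a
  have := LieModule.nontrivial_max_triv_of_isNilpotent K L M
  obtain ⟨⟨v, hv⟩, hv0⟩ := exists_ne (0 : LieModule.maxTrivSubmodule K L M)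
  refine ⟨v, fun h => hv0 (Subtype.ext h), fun a => ?_⟩
  have h := (LieModule.mem_maxTrivSubmodule K L M v).1 hv a
  rwa [hbr, sub_eq_zero] at h

/-! ### The dimension of a space generated by one more operator -/

section PowSpan

variable {K : Type*} [Field K] {M : Type*} [AddCommGroup M] [Module K M]

/-- The space `∑ x ^ a V`, where `0 ≤ a < n`. -/
def powSpan (x : Module.End K M) (V : Submodule K M) : ℕ → Submodule K M
  | 0 => ⊥
  | n + 1 => powSpan x V n ⊔ V.map (x ^ n)

variable {x : Module.End K M} {V : Submodule K M}

theorem pow_mem_powSpan {v : M} (hv : v ∈ V) {k n : ℕ} (h : k < n) :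
    (x ^ k) v ∈ powSpan x V n := by
  induction n with
  | zero => omega
  | succ n ih =>
    rcases Nat.lt_succ_iff_lt_or_eq.1 h with h | rfl
    · exact Submodule.mem_sup_left (ih h)
    · exact Submodule.mem_sup_right (Submodule.mem_map_of_mem hv)

theorem powSpan_induction {Q : M → Prop} {n : ℕ} (hadd : ∀ u v, Q u → Q v → Q (u + v)) (h0 : Q 0)
    (hpow : ∀ k < n, ∀ v ∈ V, Q ((x ^ k) v)) {u : M} (hu : u ∈ powSpan x V n) : Q u := by
  induction n generalizing u with
  | zero => rw [(Submodule.mem_bot K).1 hu]; exact h0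
  | succ n ih =>
    obtain ⟨a, ha, b, ⟨v, hv, rfl⟩, rfl⟩ := Submodule.mem_sup.1 hu
    exact hadd _ _ (ih (fun k hk => hpow k (by omega)) ha) (hpow n (by omega) v hv)

theorem powSpan_le_iff {n : ℕ} {W : Submodule K M} :
    powSpan x V n ≤ W ↔ ∀ k < n, ∀ v ∈ V, (x ^ k) v ∈ W :=
  ⟨fun h _ hk _ hv => h (pow_mem_powSpan hv hk),
    fun h _ hu => powSpan_induction (fun _ _ => W.add_mem) W.zero_mem h hu⟩

theorem powSpan_mono {m n : ℕ} (h : m ≤ n) : powSpan x V m ≤ powSpan x V n :=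
  powSpan_le_iff.2 fun _ hk _ hv => pow_mem_powSpan hv (hk.trans_le h)

theorem apply_mem_powSpan_succ {n : ℕ} {u : M} (hu : u ∈ powSpan x V n) :
    x u ∈ powSpan x V (n + 1) := by
  have h : powSpan x V n ≤ (powSpan x V (n + 1)).comap x := powSpan_le_iff.2 fun k hk v hv => by
    rw [Submodule.mem_comap, ← Module.End.mul_apply, ← pow_succ']
    exact pow_mem_powSpan hv (by omega)
  exact h hu

/-- `∑ x ^ a V`, `a < p`, is stable under `x` if `x ^ p V ⊆ V + x V`. -/
theorem apply_mem_powSpan {p : ℕ} (hp : 2 ≤ p) (hxp : ∀ v ∈ V, (x ^ p) v ∈ V ⊔ V.map x) {u : M}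
    (hu : u ∈ powSpan x V p) : x u ∈ powSpan x V p := by
  have h : powSpan x V p ≤ (powSpan x V p).comap x := powSpan_le_iff.2 fun k hk v hv => by
    rw [Submodule.mem_comap, ← Module.End.mul_apply, ← pow_succ']
    rcases Nat.lt_or_ge (k + 1) p with h | h
    · exact pow_mem_powSpan hv h
    · obtain rfl : k + 1 = p := by omega
      obtain ⟨a, ha, b, ⟨b, hb, rfl⟩, hab⟩ := Submodule.mem_sup.1 (hxp v hv)
      rw [← hab]
      refine add_mem ?_ ?_
      · simpa using pow_mem_powSpan (x := x) ha (k := 0) (n := k + 1) (by omega)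
      · simpa using pow_mem_powSpan (x := x) hb (k := 1) (n := k + 1) (by omega)
  exact h hu

variable {G : Set (Module.End K M)} (hGV : ∀ w ∈ G, ∀ v ∈ V, w v ∈ V)
  (hGx : ∀ w ∈ G, ∃ w' ∈ G, ∃ t : K, w * x = x * w + w' + t • x)

include hGV hGx

/-- `∑ x ^ a V` is stable under a set `G` of operators that stabilizes `V` and is normalized by `x`
up to multiples of `x`. -/
theorem apply_mem_powSpan_of_mem {w : Module.End K M} (hw : w ∈ G) {n : ℕ} {u : M}
    (hu : u ∈ powSpan x V n) : w u ∈ powSpan x V n := by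
  have key : ∀ k : ℕ, ∀ w ∈ G, ∀ v ∈ V, w ((x ^ k) v) ∈ powSpan x V (k + 1) := by
    intro k
    induction k with
    | zero =>
      intro w hw v hv
      simpa using pow_mem_powSpan (x := x) (hGV w hw v hv) (k := 0) (n := 1) (by omega)
    | succ k ih =>
      intro w hw v hv
      obtain ⟨w', hw', t, h⟩ := hGx w hw
      rw [pow_succ', Module.End.mul_apply, ← Module.End.mul_apply w, h]
      refine add_mem (add_mem (apply_mem_powSpan_succ (ih w hw v hv))
        (powSpan_mono (Nat.le_succ _) (ih w' hw' v hv))) (Submodule.smul_mem _ _ ?_)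
      exact apply_mem_powSpan_succ (pow_mem_powSpan hv (Nat.lt_succ_self k))
  have h : powSpan x V n ≤ (powSpan x V n).comap w := powSpan_le_iff.2 fun k hk v hv =>
    powSpan_mono (Nat.succ_le_of_lt hk) (key k w hw v hv)
  exact h hu

variable {y z : Module.End K M} {c : K} (hzx : ∃ w ∈ G, z * x = x * z + w)
  (hyV : ∀ v ∈ V, y v = c • v) (hyx : y * x = x * y + z)

include hzx

/-- Modulo lower powers of `x`, the operator `z` commutes with `x ^ n` on `V`. -/
theorem apply_pow_sub_pow_apply_mem_powSpan (n : ℕ) {v : M} (hv : v ∈ V) :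
    z ((x ^ n) v) - (x ^ n) (z v) ∈ powSpan x V n := by
  obtain ⟨w, hw, h⟩ := hzx
  induction n with
  | zero => simp
  | succ n ih =>
    have h1 : z ((x ^ (n + 1)) v) - (x ^ (n + 1)) (z v) =
        x (z ((x ^ n) v) - (x ^ n) (z v)) + w ((x ^ n) v) := by
      rw [pow_succ', Module.End.mul_apply, ← Module.End.mul_apply z, h]
      simp only [LinearMap.add_apply, Module.End.mul_apply, map_sub]
      abel
    rw [h1]
    exact add_mem (apply_mem_powSpan_succ ih)
      (apply_mem_powSpan_of_mem hGV hGx hw (pow_mem_powSpan hv (Nat.lt_succ_self n)))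

include hyV hyx

/-- Modulo lower powers of `x`, the operator `y - c` acts on `x ^ (n + 1) V` as
`(n + 1) x ^ n z`. -/
theorem apply_pow_sub_mem_powSpan (n : ℕ) {v : M} (hv : v ∈ V) :
    y ((x ^ (n + 1)) v) - c • (x ^ (n + 1)) v - ((n + 1 : ℕ) : K) • (x ^ n) (z v) ∈
      powSpan x V n := by
  induction n with
  | zero =>
    have h1 : y (x v) = x (y v) + z v := LinearMap.congr_fun hyx v
    simp [h1, hyV v hv]
  | succ n ih =>
    have h1 : y ((x ^ (n + 1 + 1)) v) - c • (x ^ (n + 1 + 1)) v -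
        ((n + 1 + 1 : ℕ) : K) • (x ^ (n + 1)) (z v) =
        x (y ((x ^ (n + 1)) v) - c • (x ^ (n + 1)) v - ((n + 1 : ℕ) : K) • (x ^ n) (z v)) +
          (z ((x ^ (n + 1)) v) - (x ^ (n + 1)) (z v)) := by
      rw [pow_succ' x (n + 1), Module.End.mul_apply, ← Module.End.mul_apply y, hyx]
      simp only [LinearMap.add_apply, Module.End.mul_apply, map_sub, map_smul, pow_succ' x n,
        Nat.cast_add, Nat.cast_one, add_smul, one_smul, map_add]
      abel
    rw [h1]
    exact add_mem (apply_mem_powSpan_succ ih)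
      (apply_pow_sub_pow_apply_mem_powSpan hGV hGx hzx (n + 1) hv)

variable (hz : z ∈ G)

include hz

/-- The operator `y - c` lowers the degree in `x`. -/
theorem apply_sub_mem_powSpan {n : ℕ} {u : M} (hu : u ∈ powSpan x V (n + 1)) :
    y u - c • u ∈ powSpan x V n := by
  have h : powSpan x V (n + 1) ≤ (powSpan x V n).comap (y - algebraMap K (Module.End K M) c) :=
    powSpan_le_iff.2 fun k hk v hv => by
      rw [Submodule.mem_comap, LinearMap.sub_apply, Module.algebraMap_end_apply]
      cases k with
      | zero => simp [hyV v hv]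
      | succ k =>
        have h1 := powSpan_mono (show k ≤ n by omega)
          (apply_pow_sub_mem_powSpan hGV hGx hzx hyV hyx k hv)
        have h2 : ((k + 1 : ℕ) : K) • (x ^ k) (z v) ∈ powSpan x V n :=
          Submodule.smul_mem _ _ (pow_mem_powSpan (hGV z hz v hv) (by omega))
        simpa using add_mem h1 h2
  exact h hu

variable {p : ℕ} [CharP K p] (hinj : ∀ v ∈ V, z v = 0 → v = 0)

include hinj

/-- The sum `∑ x ^ a V`, `a < p`, is direct, and `x ^ a` is injective on `V`. -/
theorem eq_zero_of_pow_mem_powSpan {n : ℕ} (hn : n < p) {v : M} (hv : v ∈ V)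
    (h : (x ^ n) v ∈ powSpan x V n) : v = 0 := by
  induction n generalizing v with
  | zero => simpa [powSpan] using h
  | succ n ih =>
    have h1 := apply_sub_mem_powSpan hGV hGx hzx hyV hyx hz h
    have h2 := apply_pow_sub_mem_powSpan hGV hGx hzx hyV hyx n hv
    have h3 : ((n + 1 : ℕ) : K) • (x ^ n) (z v) ∈ powSpan x V n := by
      simpa using sub_mem h1 h2
    have hne : ((n + 1 : ℕ) : K) ≠ 0 := by
      rw [Ne, CharP.cast_eq_zero_iff K p]
      intro hd
      have := Nat.le_of_dvd (Nat.succ_pos n) hd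
      omega
    exact hinj v hv (ih (by omega) (hGV z hz v hv) ((Submodule.smul_mem_iff _ hne).1 h3))

theorem finrank_powSpan [FiniteDimensional K V] {n : ℕ} (hn : n ≤ p) :
    FiniteDimensional K (powSpan x V n) ∧
      Module.finrank K (powSpan x V n) = n * Module.finrank K V := by
  induction n with
  | zero => exact ⟨inferInstanceAs (FiniteDimensional K (⊥ : Submodule K M)), by
      rw [powSpan, finrank_bot, zero_mul]⟩
  | succ n ih =>
    obtain ⟨h1, h2⟩ := ih (by omega)
    have hzero : ∀ v ∈ V, (x ^ n) v ∈ powSpan x V n → v = 0 := fun v hv h =>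
      eq_zero_of_pow_mem_powSpan hGV hGx hzx hyV hyx hz hinj (by omega) hv h
    have hmap : Module.finrank K (V.map (x ^ n)) = Module.finrank K V := by
      rw [← LinearMap.range_domRestrict]
      refine LinearMap.finrank_range_of_inj ((injective_iff_map_eq_zero _).2 fun v hv => ?_)
      refine Subtype.ext (hzero v v.2 ?_)
      rw [LinearMap.domRestrict_apply] at hv
      rw [hv]
      exact zero_mem _
    have hinf : powSpan x V n ⊓ V.map (x ^ n) = ⊥ := by
      rw [eq_bot_iff]
      rintro _ ⟨hu, v, hv, rfl⟩
      simp [hzero v hv hu]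
    have h3 := Submodule.finrank_sup_add_finrank_inf_eq (powSpan x V n) (V.map (x ^ n))
    rw [hinf, finrank_bot, add_zero, h2, hmap] at h3
    refine ⟨inferInstanceAs
      (FiniteDimensional K (powSpan x V n ⊔ V.map (x ^ n) : Submodule K M)), ?_⟩
    rw [show powSpan x V (n + 1) = powSpan x V n ⊔ V.map (x ^ n) from rfl, h3]
    ring

end PowSpan

/-! ### The `p`-map of `W_ℓ` -/

namespace WittCurrent

section

variable {K : Type*} [Field K] {p l : ℕ}

theorem act_lie (z w : WittCurrent K p l) :
    act K p l ⁅z, w⁆ = act K p l z * act K p l w - act K p l w * act K p l z := by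
  induction z using induction_on with
  | zero => simp
  | add z z' hz hz' => simp only [add_lie, map_add, hz, hz', add_mul, mul_add]; abel
  | tmul a D =>
    induction w using induction_on with
    | zero => simp
    | add w w' hw hw' => simp only [lie_add, map_add, hw, hw', add_mul, mul_add]; abel
    | tmul b E =>
      refine LinearMap.ext fun u => ?_
      induction u using TensorProduct.induction_on with
      | zero => simp
      | add u v hu hv => rw [map_add, map_add, hu, hv]
      | tmul c f =>
        rw [LinearMap.sub_apply, Module.End.mul_apply, Module.End.mul_apply, lie_tmul,
          act_tmul, act_tmul, act_tmul, act_tmul, act_tmul, Derivation.commutator_apply,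
          TensorProduct.tmul_sub, mul_assoc, mul_left_comm b a c]

variable [CharP K p]

variable (K p l) in
/-- `pMap` satisfies the axioms of a `p`-map, because `W_ℓ` acts faithfully. -/
theorem isPMap [Fact p.Prime] : IsPMap K p (pMap K p l) := by
  rcases subsingleton_or_nontrivial
    (Module.End (TruncPoly K (l + 1)) (TruncPoly K (l + 1) ⊗[K] TruncPoly K p)) with hs | hn
  · have := act_injective (K := K) (p := p) (l := l) |>.subsingleton
    exact ⟨fun _ _ => Subsingleton.elim _ _, fun _ _ => Subsingleton.elim _ _,
      fun _ _ => Subsingleton.elim _ _⟩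
  · have : CharP (Module.End (TruncPoly K (l + 1)) (TruncPoly K (l + 1) ⊗[K] TruncPoly K p)) p :=
      charP_of_injective_algebraMap (algebraMap K _).injective p
    refine ⟨fun c a => ?_, fun a b => ?_, fun a b => ?_⟩ <;> apply act_injective
    · rw [act_pMap, map_smul, map_smul, act_pMap, _root_.smul_pow]
    · rw [act_pMap, map_add, map_add, map_add, act_pMap, act_pMap]
      exact add_pow_prime_eq_jacobsonSum ⊤ (act K p l) (fun a _ b _ => act_lie a b)
        (LieSubalgebra.mem_top a) (LieSubalgebra.mem_top b)
    · rw [act_lie, act_pMap, ← ad_pow_prime]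
      have hit : ∀ n : ℕ, act K p l (((fun u => ⁅a, u⁆)^[n]) b) =
          ((fun u => act K p l a * u - u * act K p l a)^[n]) (act K p l b) := by
        intro n
        induction n with
        | zero => rfl
        | succ n ih =>
          rw [Function.iterate_succ_apply', Function.iterate_succ_apply', ← ih, act_lie]
      exact hit p

/-- The `p`-map vanishes on `W_{ℓ,(i)}` for `i ≥ 1`: elements of it raise degrees in `x`. -/
theorem pMap_eq_zero {i : ℕ} (hi : 1 ≤ i) {z : WittCurrent K p l}
    (hz : z ∈ filtSubmodule K p l i) : pMap K p l z = 0 := by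
  set J : ℕ → Submodule K (TruncPoly K (l + 1) ⊗[K] TruncPoly K p) := fun n =>
    Submodule.span K {f | ∃ k m : ℕ, n ≤ m ∧
      f = (gen K (l + 1) ^ k) ⊗ₜ[K] (gen K p ^ m)} with hJ
  have hact : ∀ n, ∀ f ∈ J n, act K p l z f ∈ J (n + 1) := by
    intro n f hf
    induction hf using Submodule.span_induction with
    | zero => simp
    | add x y _ _ hx hy => rw [map_add]; exact add_mem hx hy
    | smul c x _ hx => rw [LinearMap.map_smul_of_tower]; exact Submodule.smul_mem _ _ hx
    | mem f hf =>
      obtain ⟨k, m, hm, rfl⟩ := hf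
      induction hz using Submodule.span_induction with
      | zero => simp
      | add x y _ _ hx hy => rw [map_add, LinearMap.add_apply]; exact add_mem hx hy
      | smul c x _ hx =>
        rw [map_smul, LinearMap.smul_apply]
        exact Submodule.smul_mem _ _ hx
      | mem x hx =>
        obtain ⟨j, k', hij, hj, -, -, rfl⟩ := hx
        simp only [et, Witt.e, act_tmul, Derivation.smul_apply, Witt.del_gen_pow, smul_eq_mul,
          mul_smul_comm, TensorProduct.tmul_smul, ← pow_add]
        rcases Nat.eq_zero_or_pos m with rfl | hm0
        · simp
        · exact Submodule.smul_mem _ _ (Submodule.subset_span ⟨_, _, by omega, rfl⟩)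
  have hpow : ∀ n : ℕ, (act K p l z ^ n) (1 ⊗ₜ gen K p) ∈ J n := by
    intro n
    induction n with
    | zero => exact Submodule.subset_span ⟨0, 1, by omega, by simp⟩
    | succ n ih => rw [pow_succ', Module.End.mul_apply]; exact hact _ _ ih
  have hbot : J p = ⊥ := by
    rw [hJ, Submodule.span_eq_bot]
    rintro f ⟨k, m, hm, rfl⟩
    rw [gen_pow_eq_zero K p hm, TensorProduct.tmul_zero]
  have h0 := hpow p
  rw [hbot, Submodule.mem_bot] at h0
  rw [pMap, h0, map_zero]

end

/-! ### A flag of subalgebras of `W_ℓ` -/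

section

variable (K : Type*) [Field K] (p l : ℕ) [CharP K p]

/-- The basis element `e_i t^k` with `q = (i + 1)(ℓ + 1) + k`. It is `0` for `q ≥ p(ℓ + 1)`. -/
def basisElt (q : ℕ) : WittCurrent K p l :=
  tmul (gen K (l + 1) ^ (q % (l + 1))) (gen K p ^ (q / (l + 1)) • Witt.del K p)

variable {K p l}

theorem tmul_pow_eq_basisElt {k : ℕ} (hk : k ≤ l) (n : ℕ) :
    tmul (gen K (l + 1) ^ k) (gen K p ^ n • Witt.del K p) = basisElt K p l (n * (l + 1) + k) := by
  have h := (Nat.div_mod_unique (a := n * (l + 1) + k) (b := l + 1) (c := k) (d := n)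
    (Nat.succ_pos l)).2 ⟨by ring, Nat.lt_succ_of_le hk⟩
  rw [basisElt, h.1, h.2]

theorem et_eq_basisElt {j k : ℕ} (hk : k ≤ l) :
    et K p l ((j : ℤ) - 1) k = basisElt K p l (j * (l + 1) + k) := by
  rw [et, Witt.e, ← tmul_pow_eq_basisElt hk]
  simp

theorem basisElt_eq_et (q : ℕ) :
    basisElt K p l q = et K p l (((q / (l + 1) : ℕ) : ℤ) - 1) (q % (l + 1)) := by
  rw [et_eq_basisElt (Nat.lt_succ_iff.1 (Nat.mod_lt _ (Nat.succ_pos l))), Nat.div_add_mod']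

omit [CharP K p] in
theorem tmul_add (a : TruncPoly K (l + 1)) (D E : Witt K p) :
    (tmul a (D + E) : WittCurrent K p l) = tmul a D + tmul a E :=
  TensorProduct.tmul_add a D E

omit [CharP K p] in
theorem add_tmul (a b : TruncPoly K (l + 1)) (D : Witt K p) :
    (tmul (a + b) D : WittCurrent K p l) = tmul a D + tmul b D :=
  TensorProduct.add_tmul a b D

omit [CharP K p] in
theorem tmul_zero (a : TruncPoly K (l + 1)) : (tmul a 0 : WittCurrent K p l) = 0 :=
  TensorProduct.tmul_zero _ a

omit [CharP K p] in
theorem tmul_pow_eq_zero {k : ℕ} (hk : l < k) (D : Witt K p) :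
    (tmul (gen K (l + 1) ^ k) D : WittCurrent K p l) = 0 := by
  simp [gen_pow_eq_zero K (l + 1) (m := k) (by omega), tmul]

theorem basisElt_eq_zero {q : ℕ} (hq : p * (l + 1) ≤ q) : basisElt K p l q = 0 := by
  have : p ≤ q / (l + 1) := (Nat.le_div_iff_mul_le (Nat.succ_pos l)).2 hq
  simp [basisElt, gen_pow_eq_zero K p this, tmul]

theorem lie_basisElt_eq_zero {q q' : ℕ} (h : l + 1 ≤ q % (l + 1) + q' % (l + 1)) :
    ⁅basisElt K p l q, basisElt K p l q'⁆ = 0 := by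
  rw [basisElt, basisElt, lie_tmul, ← pow_add, tmul_pow_eq_zero (by omega)]

theorem lie_basisElt {q q' : ℕ} (h : q % (l + 1) + q' % (l + 1) < l + 1) :
    ⁅basisElt K p l q, basisElt K p l q'⁆ =
      (((q' / (l + 1) : ℕ) : K) - ((q / (l + 1) : ℕ) : K)) •
        basisElt K p l (q + q' - (l + 1)) := by
  rcases Nat.eq_zero_or_pos (q / (l + 1) + q' / (l + 1)) with h0 | h0
  · obtain ⟨h1, h2⟩ := Nat.add_eq_zero_iff.1 h0
    rw [basisElt, basisElt, lie_tmul, h1, h2, lie_self, sub_self, zero_smul, tmul_zero]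
  · have hidx : q + q' - (l + 1) =
        (q / (l + 1) + q' / (l + 1) - 1) * (l + 1) + (q % (l + 1) + q' % (l + 1)) := by
      obtain ⟨u, hu⟩ : ∃ u, q / (l + 1) + q' / (l + 1) = u + 1 := ⟨_, (Nat.sub_add_cancel h0).symm⟩
      have h3 := Nat.div_add_mod' q (l + 1)
      have h4 := Nat.div_add_mod' q' (l + 1)
      have h5 : (q / (l + 1)) * (l + 1) + (q' / (l + 1)) * (l + 1) = u * (l + 1) + (l + 1) := by
        rw [← add_mul, hu, add_mul, one_mul]
      rw [hu, Nat.add_sub_cancel]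
      omega
    rw [hidx, ← tmul_pow_eq_basisElt (by omega)]
    rw [basisElt, basisElt, lie_tmul, Witt.lie_pow_smul_del, tmul_smul, ← pow_add]

/-- The bracket of two basis elements is a multiple of the basis element with the number
`q + q' - (ℓ + 1)`. -/
theorem exists_lie_basisElt (q q' : ℕ) : ∃ c : K, ⁅basisElt K p l q, basisElt K p l q'⁆ =
    c • basisElt K p l (q + q' - (l + 1)) := by
  rcases Nat.lt_or_ge (q % (l + 1) + q' % (l + 1)) (l + 1) with h | h
  · exact ⟨_, lie_basisElt h⟩
  · exact ⟨0, by rw [lie_basisElt_eq_zero h, zero_smul]⟩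

theorem lie_basisElt_of_lt {q q' : ℕ} (hq : q < l + 1) (hq' : q' < l + 1) :
    ⁅basisElt K p l q, basisElt K p l q'⁆ = 0 := by
  rw [basisElt, basisElt, lie_tmul, Nat.div_eq_of_lt hq, Nat.div_eq_of_lt hq', lie_self, tmul_zero]

variable (K p l) in
/-- The span of the basis elements with numbers `q ≥ n`, as a Lie subalgebra. -/
def flag (n : ℕ) : LieSubalgebra K (WittCurrent K p l) :=
  { Submodule.span K (basisElt K p l '' Set.Ici n) with
    lie_mem' := by
      intro z w hz hw
      change z ∈ Submodule.span K (basisElt K p l '' Set.Ici n) at hz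
      change w ∈ Submodule.span K (basisElt K p l '' Set.Ici n) at hw
      change ⁅z, w⁆ ∈ Submodule.span K (basisElt K p l '' Set.Ici n)
      induction hz using Submodule.span_induction with
      | zero => simp
      | add x y _ _ hx hy => rw [add_lie]; exact add_mem hx hy
      | smul c x _ hx => rw [smul_lie]; exact Submodule.smul_mem _ _ hx
      | mem x hx =>
        induction hw using Submodule.span_induction with
        | zero => simp
        | add x y _ _ hx hy => rw [lie_add]; exact add_mem hx hy
        | smul c x _ hx => rw [lie_smul]; exact Submodule.smul_mem _ _ hx
        | mem y hy =>
          obtain ⟨q, hq, rfl⟩ := hx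
          obtain ⟨q', hq', rfl⟩ := hy
          rw [Set.mem_Ici] at hq hq'
          by_cases h : q < l + 1 ∧ q' < l + 1
          · rw [lie_basisElt_of_lt h.1 h.2]
            exact zero_mem _
          · obtain ⟨c, hc⟩ := exists_lie_basisElt (K := K) (p := p) (l := l) q q'
            rw [hc]
            refine Submodule.smul_mem _ _ (Submodule.subset_span ⟨_, ?_, rfl⟩)
            rw [Set.mem_Ici]
            omega }

theorem mem_flag_iff {n : ℕ} {z : WittCurrent K p l} :
    z ∈ flag K p l n ↔ z ∈ Submodule.span K (basisElt K p l '' Set.Ici n) := Iff.rfl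

theorem basisElt_mem_flag {n q : ℕ} (h : n ≤ q) : basisElt K p l q ∈ flag K p l n :=
  mem_flag_iff.2 (Submodule.subset_span ⟨q, h, rfl⟩)

theorem flag_anti {m n : ℕ} (h : m ≤ n) : flag K p l n ≤ flag K p l m := fun _ hz =>
  mem_flag_iff.2 (Submodule.span_mono (Set.image_mono (Set.Ici_subset_Ici.2 h)) (mem_flag_iff.1 hz))

theorem exists_eq_add_smul_of_mem_flag {n : ℕ} {z : WittCurrent K p l} (hz : z ∈ flag K p l n) :
    ∃ y ∈ flag K p l (n + 1), ∃ c : K, z = y + c • basisElt K p l n := by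
  rw [mem_flag_iff] at hz
  have h : basisElt K p l '' Set.Ici n =
      insert (basisElt K p l n) (basisElt K p l '' Set.Ici (n + 1)) := by
    rw [← Set.image_insert_eq]
    congr 1
    ext q
    simp only [Set.mem_Ici, Set.mem_insert_iff]
    omega
  rw [h, Submodule.mem_span_insert] at hz
  obtain ⟨c, y, hy, rfl⟩ := hz
  exact ⟨y, hy, c, add_comm _ _⟩

theorem mem_flag_iff_mem_filt (s : ℕ) {z : WittCurrent K p l} :
    z ∈ flag K p l ((s + 1) * (l + 1)) ↔ z ∈ filtSubmodule K p l s := by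
  rw [mem_flag_iff]
  constructor
  · intro h
    refine (Submodule.span_le.2 ?_) h
    rintro _ ⟨q, hq, rfl⟩
    refine pow_tmul_mem _ _ _ ?_
    have : s + 1 ≤ q / (l + 1) := (Nat.le_div_iff_mul_le (Nat.succ_pos l)).2 hq
    exact_mod_cast this
  · intro h
    refine (Submodule.span_le.2 ?_) h
    rintro _ ⟨j, k, hj, -, -, hk, rfl⟩
    obtain ⟨i, rfl⟩ : ∃ i : ℕ, j = (i : ℤ) - 1 := ⟨(j + 1).toNat, by omega⟩
    refine Submodule.subset_span ⟨_, ?_, (et_eq_basisElt hk).symm⟩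
    have h1 : s + 1 ≤ i := by omega
    have := Nat.mul_le_mul_right (l + 1) h1
    rw [Set.mem_Ici]
    omega

theorem mem_flag_zero (z : WittCurrent K p l) : z ∈ flag K p l 0 := by
  induction z using induction_on with
  | zero => exact zero_mem _
  | add z w hz hw => exact add_mem hz hw
  | tmul a D =>
    have hmem : ∀ (f : K[X]) (g : K[X]), (tmul (mk K (l + 1) g) (mk K p f • Witt.del K p) :
        WittCurrent K p l) ∈ flag K p l 0 := by
      intro f g
      induction f using Polynomial.induction_on' with
      | add f f' h h' =>
        rw [map_add, add_smul, tmul_add]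
        exact add_mem h h'
      | monomial n c =>
        rw [mk_monomial, smul_assoc, tmul_smul]
        refine (flag K p l 0).smul_mem c ?_
        induction g using Polynomial.induction_on' with
        | add g g' h h' =>
          rw [map_add, add_tmul]
          exact add_mem h h'
        | monomial k d =>
          rw [mk_monomial]
          refine (flag K p l 0).smul_mem d (x := tmul (gen K (l + 1) ^ k) _) ?_
          rcases Nat.lt_or_ge l k with hk | hk
          · rw [tmul_pow_eq_zero hk]; exact zero_mem _
          · rw [tmul_pow_eq_basisElt hk]; exact basisElt_mem_flag (Nat.zero_le _)
    obtain ⟨f, hf⟩ := mk_surjective K p (D (gen K p))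
    obtain ⟨g, rfl⟩ := mk_surjective K (l + 1) a
    rw [← Witt.smul_del_eq D, ← hf]
    exact hmem f g

variable (K p l) in
theorem finite_wittCurrent : Module.Finite K (WittCurrent K p l) := by
  classical
  refine ⟨⟨(Finset.range (p * (l + 1))).image (basisElt K p l), ?_⟩⟩
  rw [eq_top_iff]
  intro z _
  refine Submodule.span_le.2 ?_ (mem_flag_iff.1 (mem_flag_zero z))
  rintro _ ⟨q, -, rfl⟩
  rcases Nat.lt_or_ge q (p * (l + 1)) with hq | hq
  · exact Submodule.subset_span (by simpa using ⟨q, hq, rfl⟩)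
  · rw [basisElt_eq_zero hq]; exact zero_mem _

variable [hp : Fact p.Prime]

theorem pMap_basisElt_mem (n : ℕ) : pMap K p l (basisElt K p l n) ∈ flag K p l n := by
  rw [basisElt_eq_et, pMap_et _ (by linarith [Int.natCast_nonneg (n / (l + 1))])]
  split_ifs with h
  · have h1 : n / (l + 1) = 1 := by exact_mod_cast sub_eq_zero.1 h
    have h2 := Nat.div_add_mod' n (l + 1)
    rw [h1] at h2
    rcases Nat.lt_or_ge l (n % (l + 1) * p) with hk | hk
    · rw [et, tmul_pow_eq_zero hk]; exact zero_mem _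
    · rw [et_eq_basisElt hk, h1]
      refine basisElt_mem_flag ?_
      have := Nat.le_mul_of_pos_right (n % (l + 1)) hp.out.pos
      omega
  · exact zero_mem _

end

universe u

/-! ### Existence of a representation with `p`-character `χ` -/

section

variable {K : Type u} [Field K] {p l : ℕ} [CharP K p]
  {χ : Module.Dual K (WittCurrent K p l)} {r : ℕ}

/-- If `χ` vanishes on `W_{ℓ,(r)}`, it vanishes on `⁅W_{ℓ,(s)}, W_{ℓ,(s)}⁆` for `r ≤ 2s + 1`, as
`⁅e_s t^j, e_s t^k⁆ = 0`. -/
theorem apply_lie_eq_zero (hχr : ∀ z ∈ flag K p l ((r + 1) * (l + 1)), χ z = 0) {s : ℕ}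
    (hs : r ≤ 2 * s + 1) {a b : WittCurrent K p l} (ha : a ∈ flag K p l ((s + 1) * (l + 1)))
    (hb : b ∈ flag K p l ((s + 1) * (l + 1))) : χ ⁅a, b⁆ = 0 := by
  rw [mem_flag_iff] at ha hb
  induction ha using Submodule.span_induction with
  | zero => simp
  | add x y _ _ hx hy => rw [add_lie, map_add, hx, hy, add_zero]
  | smul c x _ hx => rw [smul_lie, map_smul, hx, smul_zero]
  | mem x hx =>
    induction hb using Submodule.span_induction with
    | zero => simp
    | add x y _ _ hx hy => rw [lie_add, map_add, hx, hy, add_zero]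
    | smul c x _ hx => rw [lie_smul, map_smul, hx, smul_zero]
    | mem y hy =>
      obtain ⟨q, hq, rfl⟩ := hx
      obtain ⟨q', hq', rfl⟩ := hy
      rw [Set.mem_Ici] at hq hq'
      have h1 : s + 1 ≤ q / (l + 1) := (Nat.le_div_iff_mul_le (Nat.succ_pos l)).2 hq
      have h2 : s + 1 ≤ q' / (l + 1) := (Nat.le_div_iff_mul_le (Nat.succ_pos l)).2 hq'
      rcases Nat.lt_or_ge (q % (l + 1) + q' % (l + 1)) (l + 1) with h | h
      · rw [lie_basisElt h, map_smul]
        by_cases heq : q / (l + 1) = q' / (l + 1)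
        · rw [heq, sub_self, zero_smul]
        · rw [hχr _ (basisElt_mem_flag ?_), smul_zero]
          have h3 : r + 2 ≤ q / (l + 1) + q' / (l + 1) := by omega
          have h4 := Nat.mul_le_mul_right (l + 1) h3
          have h5 := Nat.div_mul_le_self q (l + 1)
          have h6 := Nat.div_mul_le_self q' (l + 1)
          simp only [add_mul] at h4 ⊢
          omega
      · rw [lie_basisElt_eq_zero h, map_zero]

/-- There is a non-zero representation of `W_ℓ` with `p`-character `χ`: one-dimensional on
`W_{ℓ,(s)}`, and extended along the flag. -/
theorem exists_isReducedRep [Fact p.Prime]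
    (hχr : ∀ z ∈ flag K p l ((r + 1) * (l + 1)), χ z = 0) {s : ℕ}
    (hs1 : 1 ≤ s) (hs : r ≤ 2 * s + 1) (n : ℕ) (hn : n ≤ (s + 1) * (l + 1)) :
    ∃ (M : Type u) (_ : AddCommGroup M) (_ : Module K M)
      (ρ : WittCurrent K p l →ₗ[K] Module.End K M),
      Nontrivial M ∧ IsReducedRep p (pMap K p l) χ (flag K p l n) ρ ∧
      ∀ a ∈ flag K p l n, pMap K p l a ∈ flag K p l n := by
  induction hn using Nat.decreasingInduction with
  | self =>
    refine ⟨K, inferInstance, inferInstance, χ.smulRight 1, inferInstance, ⟨?_, ?_⟩, ?_⟩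
    · intro a ha b hb
      refine LinearMap.ext fun v => ?_
      simp [apply_lie_eq_zero hχr hs ha hb, mul_left_comm]
    · intro a ha
      rw [pMap_eq_zero hs1 ((mem_flag_iff_mem_filt s).1 ha), map_zero, zero_add,
        Algebra.algebraMap_eq_smul_one]
      simp [_root_.smul_pow]
    · intro a ha
      rw [pMap_eq_zero hs1 ((mem_flag_iff_mem_filt s).1 ha)]
      exact zero_mem _
  | of_succ n hn ih =>
    obtain ⟨M, _, _, ρ, _, hρ, hP⟩ := ih
    by_cases hmem : basisElt K p l n ∈ flag K p l (n + 1)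
    · have : flag K p l n = flag K p l (n + 1) := by
        refine le_antisymm (fun z hz => ?_) (flag_anti (Nat.le_succ n))
        obtain ⟨y, hy, c, rfl⟩ := exists_eq_add_smul_of_mem_flag hz
        exact add_mem hy ((flag K p l (n + 1)).smul_mem c hmem)
      rw [this]
      exact ⟨M, _, _, ρ, ‹_›, hρ, hP⟩
    · obtain ⟨R, ρ', hR, hρ'⟩ := hρ.exists_extension (isPMap K p l)
        (flag_anti (Nat.le_succ n)) (basisElt_mem_flag le_rfl) hmem
        (fun z hz => exists_eq_add_smul_of_mem_flag hz) hP (pMap_basisElt_mem n)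
      exact ⟨_, _, _, ρ', hR, hρ', (isPMap K p l).mem_of_forall_eq_add_smul
        (flag_anti (Nat.le_succ n)) (basisElt_mem_flag le_rfl)
        (fun z hz => exists_eq_add_smul_of_mem_flag hz) hP (pMap_basisElt_mem n)⟩

end

end WittCurrent

/-! ### The subspace generated by a common eigenvector of `W_{ℓ,(s)}` -/

namespace WittCurrent

section

variable {K : Type*} [Field K] {p l : ℕ} [CharP K p]
  {χ : Module.Dual K (WittCurrent K p l)} {r : ℕ}
  {M : Type*} [AddCommGroup M] [Module K M] {ρ : WittCurrent K p l →ₗ[K] Module.End K M}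

/-- The element `y = e_{r-1-i} t^{ℓ-k}` pairs non-trivially with `x = e_i t^k`: their bracket is a
non-zero multiple of `e_{r-1} t^ℓ`, because `r + 1 < p`. -/
theorem exists_lie_basisElt_dual {s : ℕ} (hs : 2 * s ≤ r) (hr : r < p - 1) {n : ℕ}
    (hn : n < (s + 1) * (l + 1)) :
    ∃ c : K, c ≠ 0 ∧ ⁅basisElt K p l ((r + 2) * (l + 1) - 1 - n), basisElt K p l n⁆ =
      c • basisElt K p l ((r + 1) * (l + 1) - 1) := by
  set u := n / (l + 1) with hu
  have hus : u ≤ s := Nat.lt_succ_iff.1 ((Nat.div_lt_iff_lt_mul (Nat.succ_pos l)).2 hn)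
  have hk : n % (l + 1) < l + 1 := Nat.mod_lt _ (Nat.succ_pos l)
  have hn' := Nat.div_add_mod' n (l + 1)
  rw [← hu] at hn'
  obtain ⟨w, hw⟩ : ∃ w, r + 1 = u + w := ⟨r + 1 - u, by omega⟩
  set k := n % (l + 1)
  have hq : (r + 2) * (l + 1) - 1 - n = w * (l + 1) + (l - k) := by
    have : (r + 2) * (l + 1) = u * (l + 1) + w * (l + 1) + (l + 1) := by
      rw [← add_mul, ← hw]; ring
    omega
  obtain ⟨hd, hm⟩ := (Nat.div_mod_unique (a := w * (l + 1) + (l - k)) (b := l + 1) (c := l - k)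
    (d := w) (Nat.succ_pos l)).2 ⟨by ring, by omega⟩
  rw [hq, lie_basisElt (by rw [hm]; change l - k + k < l + 1; omega), hd, ← hu]
  refine ⟨(u : K) - (w : K), ?_, ?_⟩
  · -- the coefficient is `u - w`, where `0 < w - u < p`
    rw [sub_ne_zero, ne_comm]
    intro h
    have h1 := ((CharP.natCast_eq_natCast K p).1 h).symm
    have h2 := (Nat.modEq_iff_dvd' (show u ≤ w by omega)).1 h1
    have h3 := Nat.le_of_dvd (by omega) h2
    have h4 : w - u ≤ w := Nat.sub_le w u
    omega
  · congr 2
    have : (r + 1) * (l + 1) = u * (l + 1) + w * (l + 1) := by rw [hw, add_mul]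
    omega

variable [hp : Fact p.Prime]

/-- A common eigenvector `v` of `W_{ℓ,(s)}` lies in a stable subspace of dimension
`p ^ ((ℓ + 1)(s + 1))`. It is built along the flag: with `x = e_i t^k` the next element, the space
`V` is replaced by `∑ x ^ a V`, whose dimension is `p · dim V`, because `y = e_{r-1-i} t^{ℓ-k}` acts
on `V` as a scalar and `⁅y, x⁆`, a multiple of `e_{r-1} t^ℓ`, is invertible. -/
theorem exists_stable_of_eigenvector (hρ : IsReducedRep p (pMap K p l) χ ⊤ ρ)
    (hχr : ∀ z ∈ flag K p l ((r + 1) * (l + 1)), χ z = 0)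
    (hχ : χ (basisElt K p l ((r + 1) * (l + 1) - 1)) ≠ 0) (hr1 : 1 < r) (hr2 : r < p - 1)
    {s : ℕ} (hs : 2 * s ≤ r) (hs1 : 1 ≤ s) {v : M} (hv0 : v ≠ 0)
    (hv : ∀ y ∈ flag K p l ((s + 1) * (l + 1)), ρ y v = χ y • v)
    {n : ℕ} (hn : n ≤ (s + 1) * (l + 1)) :
    ∃ V : Submodule K M, v ∈ V ∧ FiniteDimensional K V ∧
      Module.finrank K V = p ^ ((s + 1) * (l + 1) - n) ∧
      (∀ y ∈ flag K p l n, ∀ u ∈ V, ρ y u ∈ V) ∧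
      (∀ q, (r + 2) * (l + 1) - n ≤ q → q < (r + 2) * (l + 1) →
        ∀ u ∈ V, ρ (basisElt K p l q) u = χ (basisElt K p l q) • u) ∧
      (l + 1 ≤ n → ∀ q, (r + 1) * (l + 1) ≤ q → ∀ u ∈ V, ρ (basisElt K p l q) u = 0) := by
  have hlie : ∀ a b, ρ ⁅a, b⁆ = ρ a * ρ b - ρ b * ρ a := fun a b =>
    hρ.lie a (LieSubalgebra.mem_top a) b (LieSubalgebra.mem_top b)
  have hpow := fun a => hρ.pow a (LieSubalgebra.mem_top a)
  induction hn using Nat.decreasingInduction with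
  | self =>
    refine ⟨K ∙ v, Submodule.mem_span_singleton_self v, inferInstance, ?_, ?_, ?_, ?_⟩
    · rw [finrank_span_singleton hv0, Nat.sub_self, pow_zero]
    · intro y hy u hu
      obtain ⟨c, rfl⟩ := Submodule.mem_span_singleton.1 hu
      rw [map_smul, hv y hy]
      exact Submodule.smul_mem _ _ (Submodule.smul_mem _ _ (Submodule.mem_span_singleton_self v))
    · intro q hq _ u hu
      obtain ⟨c, rfl⟩ := Submodule.mem_span_singleton.1 hu
      rw [map_smul, hv _ (basisElt_mem_flag ?_), smul_comm]
      have := Nat.mul_le_mul_right (l + 1) (show s + 1 + (s + 1) ≤ r + 2 by omega)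
      rw [add_mul (s + 1)] at this
      omega
    · intro _ q hq u hu
      obtain ⟨c, rfl⟩ := Submodule.mem_span_singleton.1 hu
      have := Nat.mul_le_mul_right (l + 1) (show s + 1 ≤ r + 1 by omega)
      rw [map_smul, hv _ (basisElt_mem_flag (this.trans hq)), hχr _ (basisElt_mem_flag hq),
        zero_smul, smul_zero]
  | of_succ n hn ih =>
    obtain ⟨V, hvV, hfin, hrank, hstab, hI1, hI2⟩ := ih
    obtain ⟨c, hc0, hc⟩ := exists_lie_basisElt_dual (K := K) (l := l) hs hr2 hn
    have hsr := Nat.mul_le_mul_right (l + 1) (show s + 1 ≤ r by omega)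
    have h2r := Nat.mul_le_mul_right (l + 1) (show 2 ≤ r by omega)
    have hr1m : (r + 1) * (l + 1) = r * (l + 1) + (l + 1) := by ring
    have hr2m : (r + 2) * (l + 1) = r * (l + 1) + 2 * (l + 1) := by ring
    set x := ρ (basisElt K p l n) with hx
    set G : Set (Module.End K M) := ρ '' (flag K p l (n + 1) : Set (WittCurrent K p l)) with hG
    have hGV : ∀ w ∈ G, ∀ u ∈ V, w u ∈ V := by
      rintro _ ⟨w, hw, rfl⟩ u hu
      exact hstab w hw u hu
    have hGx : ∀ w ∈ G, ∃ w' ∈ G, ∃ t : K, w * x = x * w + w' + t • x := by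
      rintro _ ⟨w, hw, rfl⟩
      obtain ⟨w', hw', t, h⟩ := exists_eq_add_smul_of_mem_flag
        ((flag K p l n).lie_mem (flag_anti (Nat.le_succ n) hw) (basisElt_mem_flag le_rfl))
      refine ⟨_, ⟨w', hw', rfl⟩, t, ?_⟩
      have h1 := hlie w (basisElt K p l n)
      rw [h, map_add, map_smul] at h1
      rw [add_assoc, hx, h1]
      abel
    set z := ρ (c • basisElt K p l ((r + 1) * (l + 1) - 1)) with hz
    have hzG : z ∈ G :=
      ⟨_, (flag K p l (n + 1)).smul_mem c (basisElt_mem_flag (by omega)), rfl⟩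
    have hzx : ∃ w ∈ G, z * x = x * z + w := by
      obtain ⟨c', h⟩ := exists_lie_basisElt (K := K) (p := p) (l := l) ((r + 1) * (l + 1) - 1) n
      refine ⟨_, ⟨⁅c • basisElt K p l ((r + 1) * (l + 1) - 1), basisElt K p l n⁆, ?_, rfl⟩, ?_⟩
      · rw [smul_lie, h]
        exact (flag K p l (n + 1)).smul_mem _
          ((flag K p l (n + 1)).smul_mem _ (basisElt_mem_flag (by omega)))
      · rw [hlie]
        abel
    have hyV := hI1 ((r + 2) * (l + 1) - 1 - n) (by omega) (by omega)
    have hyx : ρ (basisElt K p l ((r + 2) * (l + 1) - 1 - n)) * x =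
        x * ρ (basisElt K p l ((r + 2) * (l + 1) - 1 - n)) + z := by
      rw [hz, ← hc, hlie]
      abel
    have hinj : ∀ u ∈ V, z u = 0 → u = 0 := by
      intro u _ hu
      -- the `p`-th power of `z` is the non-zero scalar `(c χ(e_{r-1} t^ℓ)) ^ p`
      have h1 := LinearMap.congr_fun (hpow (c • basisElt K p l ((r + 1) * (l + 1) - 1))) u
      have h2 : c • basisElt K p l ((r + 1) * (l + 1) - 1) ∈ filtSubmodule K p l (1 : ℕ) :=
        (mem_flag_iff_mem_filt 1).1
          ((flag K p l _).smul_mem c (basisElt_mem_flag (by omega)))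
      obtain ⟨m, hm⟩ : ∃ m, p = m + 1 := ⟨p - 1, by have := hp.out.pos; omega⟩
      have h3 : (z ^ p) u = 0 := by rw [hm, pow_succ, Module.End.mul_apply, hu, map_zero]
      rw [pMap_eq_zero le_rfl h2, map_zero, zero_add, ← hz, h3, Module.algebraMap_end_apply,
        eq_comm, map_smul, smul_eq_mul] at h1
      exact (smul_eq_zero.1 h1).resolve_left (pow_ne_zero p (mul_ne_zero hc0 hχ))
    have hxp : ∀ u ∈ V, (x ^ p) u ∈ V ⊔ V.map x := by
      intro u hu
      obtain ⟨w, hw, t, h⟩ :=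
        exists_eq_add_smul_of_mem_flag (pMap_basisElt_mem (K := K) (p := p) (l := l) n)
      rw [hx, hpow, h, map_add, map_smul]
      refine add_mem (add_mem ?_ ?_) ?_
      · exact Submodule.mem_sup_left (hstab w hw u hu)
      · exact Submodule.smul_mem _ _ (Submodule.mem_sup_right (Submodule.mem_map_of_mem hu))
      · exact Submodule.smul_mem _ _ (Submodule.mem_sup_left hu)
    obtain ⟨hfin', hrank'⟩ := finrank_powSpan hGV hGx hzx hyV hyx hzG hinj (le_refl p)
    have hcommx : ∀ (a : WittCurrent K p l) (u : M),
        ρ a (x u) = x (ρ a u) + ρ ⁅a, basisElt K p l n⁆ u := by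
      intro a u
      rw [hlie, LinearMap.sub_apply, Module.End.mul_apply, Module.End.mul_apply]
      abel
    have hI2' : l + 1 ≤ n → ∀ k q, (r + 1) * (l + 1) ≤ q → ∀ u ∈ V,
        ρ (basisElt K p l q) ((x ^ k) u) = 0 := by
      intro hln k
      induction k with
      | zero => intro q hq u hu; exact hI2 (by omega) q hq u hu
      | succ k ihk =>
        intro q hq u hu
        obtain ⟨c', h⟩ := exists_lie_basisElt (K := K) (p := p) (l := l) q n
        rw [pow_succ', Module.End.mul_apply, hcommx, ihk q hq u hu, h, map_smul,
          LinearMap.smul_apply, ihk _ (by omega) u hu, map_zero, smul_zero, add_zero]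
    refine ⟨powSpan x V p, ?_, hfin', ?_, ?_, ?_, ?_⟩
    · simpa using pow_mem_powSpan (x := x) hvV hp.out.pos
    · rw [hrank', hrank, ← pow_succ']
      congr 1
      omega
    · intro y hy u hu
      obtain ⟨w, hw, t, rfl⟩ := exists_eq_add_smul_of_mem_flag hy
      rw [map_add, map_smul]
      exact add_mem (apply_mem_powSpan_of_mem hGV hGx ⟨w, hw, rfl⟩ hu)
        (Submodule.smul_mem _ _ (apply_mem_powSpan hp.out.two_le hxp hu))
    · intro q hq hq' u hu
      refine powSpan_induction (x := x) (V := V) (n := p)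
        (Q := fun u => ρ (basisElt K p l q) u = χ (basisElt K p l q) • u)
        (fun a b ha hb => by rw [map_add, ha, hb, smul_add]) (by simp) ?_ hu
      intro k _ u hu
      clear * - hI1 hI2' hcommx hq hq' hn hu hr1m hr2m
      induction k with
      | zero => exact hI1 q (by omega) hq' u hu
      | succ k ihk =>
        have h0 : ρ ⁅basisElt K p l q, basisElt K p l n⁆ ((x ^ k) u) = 0 := by
          rcases Nat.lt_or_ge n (l + 1) with hln | hln
          · -- here `x = e_{-1} t^n` and `e_r t^j` commute, as `n + j > ℓ`
            have hmod : q % (l + 1) = q - (r + 1) * (l + 1) := by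
              refine ((Nat.div_mod_unique (d := r + 1) (Nat.succ_pos l)).2 ⟨?_, by omega⟩).2
              rw [Nat.succ_eq_add_one, mul_comm (l + 1)]
              omega
            rw [lie_basisElt_eq_zero (by rw [hmod, Nat.mod_eq_of_lt hln]; omega), map_zero,
              LinearMap.zero_apply]
          · obtain ⟨c', h⟩ := exists_lie_basisElt (K := K) (p := p) (l := l) q n
            rw [h, map_smul, LinearMap.smul_apply, hI2' hln _ _ (by omega) u hu, smul_zero]
        rw [pow_succ', Module.End.mul_apply, hcommx, ihk, h0, add_zero, map_smul]
    · intro hln q hq u hu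
      exact powSpan_induction (x := x) (V := V) (n := p)
        (Q := fun u => ρ (basisElt K p l q) u = 0)
        (fun a b ha hb => by rw [map_add, ha, hb, add_zero]) (by simp)
        (fun k _ u hu => hI2' hln k q hq u hu) hu

end

end WittCurrent

/-! ### Modules over reduced enveloping algebras -/

namespace ReducedEnveloping

attribute [local instance 100] LieRing.ofAssociativeRing

section

variable {K : Type*} [Field K] {L : Type*} [LieRing L] [LieAlgebra K L] {p : ℕ} {P : L → L}
  {χ : Module.Dual K L}

theorem ι_lie (a b : L) : ι p P χ ⁅a, b⁆ = ι p P χ a * ι p P χ b - ι p P χ b * ι p P χ a := by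
  simp only [ι, LieHom.map_lie, LieRing.of_associative_ring_bracket, map_sub, map_mul]

theorem ι_pow (a : L) : ι p P χ a ^ p = ι p P χ (P a) + algebraMap K _ (χ a ^ p) := by
  have h := RingQuot.mkAlgHom_rel K (Rel.pow (p := p) (P := P) (χ := χ) a)
  rw [map_sub, map_pow, AlgHom.commutes, sub_eq_iff_eq_add'] at h
  exact h

variable (p P χ) in
/-- The algebra `U_χ(L)` is generated by the image of `L`. -/
theorem adjoin_range_ι : Algebra.adjoin K (Set.range (ι p P χ)) = ⊤ := by
  set T := Algebra.adjoin K (Set.range (ι p P χ))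
  have hT : ∀ x, ι p P χ x ∈ T := fun x => Algebra.subset_adjoin ⟨x, rfl⟩
  let f : L →ₗ⁅K⁆ T :=
    { toFun := fun x => ⟨ι p P χ x, hT x⟩
      map_add' := fun a b => Subtype.ext (by simp only [ι, map_add]; rfl)
      map_smul' := fun c a => Subtype.ext (by simp only [ι, map_smul]; rfl)
      map_lie' := fun {a b} => Subtype.ext (ι_lie a b) }
  have hcomp : T.val.comp (UniversalEnvelopingAlgebra.lift K f) =
      RingQuot.mkAlgHom K (Rel p P χ) := by
    refine UniversalEnvelopingAlgebra.hom_ext K (LieHom.ext fun x => ?_)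
    change T.val (UniversalEnvelopingAlgebra.lift K f (UniversalEnvelopingAlgebra.ι K x)) = _
    rw [UniversalEnvelopingAlgebra.lift_ι_apply]
    rfl
  rw [eq_top_iff]
  intro u _
  obtain ⟨u, rfl⟩ := RingQuot.mkAlgHom_surjective K (Rel p P χ) u
  rw [← hcomp]
  exact (UniversalEnvelopingAlgebra.lift K f u).2

/-- The universal property of `U_χ(L)`. -/
theorem exists_algHom {A : Type*} [Ring A] [Algebra K A] (f : L →ₗ[K] A)
    (hlie : ∀ a b : L, f ⁅a, b⁆ = f a * f b - f b * f a)
    (hpow : ∀ a, f a ^ p = f (P a) + algebraMap K A (χ a ^ p)) :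
    ∃ F : ReducedEnveloping p P χ →ₐ[K] A, ∀ a, F (ι p P χ a) = f a := by
  let f' : L →ₗ⁅K⁆ A := { f with map_lie' := fun {a b} => hlie a b }
  have hf' : ∀ a, UniversalEnvelopingAlgebra.lift K f' (UniversalEnvelopingAlgebra.ι K a) = f a :=
    fun a => UniversalEnvelopingAlgebra.lift_ι_apply K f' a
  refine ⟨RingQuot.liftAlgHom K ⟨UniversalEnvelopingAlgebra.lift K f', ?_⟩, fun a => ?_⟩
  · rintro _ _ ⟨a⟩
    rw [map_sub, map_pow, AlgHom.commutes, hf', hf', hpow, add_sub_cancel_left]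
  · rw [ι, RingQuot.liftAlgHom_mkAlgHom_apply, hf']

/-- A common eigenvector of `L` is a common eigenvector of `U_χ(L)`. -/
theorem apply_eq_smul_of_forall_ι {M : Type*} [AddCommGroup M] [Module K M]
    (ψ : ReducedEnveloping p P χ →ₐ[K] Module.End K M) (ε : ReducedEnveloping p P χ →ₐ[K] K)
    {v : M} (h : ∀ a, ψ (ι p P χ a) v = ε (ι p P χ a) • v) (u : ReducedEnveloping p P χ) :
    ψ u v = ε u • v := by
  have hu : u ∈ Algebra.adjoin K (Set.range (ι p P χ)) := adjoin_range_ι p P χ ▸ Algebra.mem_top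
  induction hu using Algebra.adjoin_induction with
  | mem x hx => obtain ⟨a, rfl⟩ := hx; exact h a
  | algebraMap c => simp [Module.algebraMap_end_apply]
  | add a b _ _ ha hb => rw [map_add, LinearMap.add_apply, ha, hb, map_add, add_smul]
  | mul a b _ _ ha hb =>
    rw [map_mul, Module.End.mul_apply, hb, map_smul, ha, map_mul, smul_smul, mul_comm]

section Module

variable (M : Type*) [AddCommGroup M] [Module K M] [Module (ReducedEnveloping p P χ) M]
  [IsScalarTower K (ReducedEnveloping p P χ) M]

variable (p P χ) in
/-- The representation of `L` on a `U_χ(L)`-module. -/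
def toRep : L →ₗ[K] Module.End K M where
  toFun a := Algebra.lsmul K K M (ι p P χ a)
  map_add' a b := by simp only [ι, map_add]
  map_smul' c a := by simp only [ι, map_smul, RingHom.id_apply]

theorem toRep_apply (a : L) (v : M) : toRep p P χ M a v = ι p P χ a • v := rfl

theorem toRep_lie (a b : L) : toRep p P χ M ⁅a, b⁆ =
    toRep p P χ M a * toRep p P χ M b - toRep p P χ M b * toRep p P χ M a := by
  refine LinearMap.ext fun v => ?_
  simp [toRep_apply, ι_lie, sub_smul, mul_smul]

theorem toRep_pow (a : L) : toRep p P χ M a ^ p =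
    toRep p P χ M (P a) + algebraMap K (Module.End K M) (χ a ^ p) := by
  refine LinearMap.ext fun v => ?_
  change ((Algebra.lsmul K K M (ι p P χ a)) ^ p) v = _
  rw [← map_pow, ι_pow, map_add, AlgHom.commutes]
  rfl

theorem isReducedRep_toRep : IsReducedRep p P χ ⊤ (toRep p P χ M) :=
  ⟨fun a _ b _ => toRep_lie M a b, fun a _ => toRep_pow M a⟩

variable {M} in
/-- A subspace stable under `L` is a `U_χ(L)`-submodule. -/
theorem smul_mem_of_forall_ι {V : Submodule K M} (h : ∀ a, ∀ v ∈ V, ι p P χ a • v ∈ V)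
    (u : ReducedEnveloping p P χ) {v : M} (hv : v ∈ V) : u • v ∈ V := by
  have hu : u ∈ Algebra.adjoin K (Set.range (ι p P χ)) := adjoin_range_ι p P χ ▸ Algebra.mem_top
  induction hu using Algebra.adjoin_induction generalizing v with
  | mem x hx => obtain ⟨a, rfl⟩ := hx; exact h a v hv
  | algebraMap c => rw [algebraMap_smul]; exact V.smul_mem c hv
  | add a b _ _ ha hb => rw [add_smul]; exact add_mem (ha hv) (hb hv)
  | mul a b _ _ ha hb => rw [mul_smul]; exact ha (hb hv)

end Module

end

end ReducedEnveloping

/-! ### Modules induced from a character -/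

section

variable {K : Type*} [Field K] {U V : Type*} [Ring U] [Algebra K U] [Ring V] [Algebra K V]
  (φ : V →ₐ[K] U) (ε : V →ₐ[K] K)

/-- The identification of the vector space underlying `CharModule ε` with `K`. -/
def CharModule.toField : CharModule ε ≃ₗ[K] K := LinearEquiv.refl K K

theorem CharModule.toField_smul (w : V) (c : CharModule ε) :
    CharModule.toField ε (w • c) = ε w * CharModule.toField ε c := rfl

namespace InducedModule

/-- The generator `1 ⊗ 1`. -/
def one : InducedModule φ (CharModule ε) :=
  Submodule.Quotient.mk ((1 : U) ⊗ₜ[K] (CharModule.toField ε).symm 1)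

theorem span_one : Submodule.span U {one φ ε} = ⊤ := by
  rw [eq_top_iff]
  intro z _
  obtain ⟨z, rfl⟩ := Submodule.Quotient.mk_surjective _ z
  induction z using TensorProduct.induction_on with
  | zero => exact zero_mem _
  | add a b ha hb => exact add_mem (ha trivial) (hb trivial)
  | tmul u c =>
    rw [Submodule.mem_span_singleton]
    refine ⟨CharModule.toField ε c • u, ?_⟩
    rw [one, ← Submodule.Quotient.mk_smul, TensorProduct.smul_tmul', smul_eq_mul, mul_one,
      TensorProduct.smul_tmul, ← map_smul, smul_eq_mul, mul_one, LinearEquiv.symm_apply_apply]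

theorem smul_one (w : V) : φ w • one φ ε = ε w • one φ ε := by
  have h : (φ w) ⊗ₜ[K] (CharModule.toField ε).symm 1 -
      (1 : U) ⊗ₜ[K] (w • (CharModule.toField ε).symm 1) ∈ Submodule.span U
        {z : U ⊗[K] CharModule ε | ∃ (u : U) (v : V) (n : CharModule ε),
          z = (u * φ v) ⊗ₜ[K] n - u ⊗ₜ[K] (v • n)} :=
    Submodule.subset_span ⟨1, w, _, by rw [one_mul]⟩
  rw [one, ← Submodule.Quotient.mk_smul, TensorProduct.smul_tmul', smul_eq_mul, mul_one,
    (Submodule.Quotient.eq _).2 h]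
  have h1 : w • (CharModule.toField ε).symm 1 = ε w • (CharModule.toField ε).symm 1 := rfl
  rw [h1, TensorProduct.tmul_smul]
  rfl

variable {φ ε} in
/-- The universal property of a module induced from a character. -/
theorem exists_lift {M : Type*} [AddCommGroup M] [Module K M] [Module U M] [IsScalarTower K U M]
    {v : M} (hv : ∀ w, φ w • v = ε w • v) :
    ∃ f : InducedModule φ (CharModule ε) →ₗ[U] M, f (one φ ε) = v := by
  let e : U ⊗[K] CharModule ε →ₗ[U] U :=
    (TensorProduct.AlgebraTensorModule.rid K U U).toLinearMap ∘ₗ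
      TensorProduct.AlgebraTensorModule.map LinearMap.id (CharModule.toField ε).toLinearMap
  have he : ∀ (u : U) (c : CharModule ε), e (u ⊗ₜ c) = CharModule.toField ε c • u := fun u c => by
    simp [e]
  refine ⟨Submodule.liftQ _ (LinearMap.toSpanSingleton U M v ∘ₗ e) ?_, ?_⟩
  · rw [Submodule.span_le]
    rintro _ ⟨u, w, n, rfl⟩
    rw [SetLike.mem_coe, LinearMap.mem_ker, LinearMap.comp_apply, map_sub, he, he,
      CharModule.toField_smul, LinearMap.toSpanSingleton_apply, sub_smul, smul_assoc, smul_assoc,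
      mul_smul, hv, mul_comm, mul_smul, smul_algebra_smul_comm, sub_self]
  · rw [one]
    refine (Submodule.liftQ_apply _ _ _).trans ?_
    rw [LinearMap.comp_apply, he, LinearEquiv.apply_symm_apply, one_smul,
      LinearMap.toSpanSingleton_apply, one_smul]

end InducedModule

end

/-! ### Simple modules of `U_χ(W_{ℓ,(s)})` and `U_χ(W_ℓ)` -/

namespace WittCurrent

open ReducedEnveloping

section

variable {K : Type*} [Field K] {p l : ℕ} [CharP K p]
  {χ : Module.Dual K (WittCurrent K p l)} {r : ℕ}

/-- The vanishing of `χ` on `W_{ℓ,(r)}`, as the infimum in the definition of the height is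
attained. -/
theorem apply_eq_zero_of_height_eq (hr : height K p l χ = (r : ℤ)) (hr1 : 1 < r)
    {z : WittCurrent K p l} (hz : z ∈ flag K p l ((r + 1) * (l + 1))) : χ z = 0 := by
  rw [height] at hr
  have hne : {i : ℤ | -1 ≤ i ∧ ∀ z ∈ filtSubmodule K p l i, χ z = 0}.Nonempty := by
    by_contra h
    rw [Set.not_nonempty_iff_eq_empty.1 h, Int.csInf_empty] at hr
    omega
  have h := Int.csInf_mem hne ⟨-1, fun i hi => hi.1⟩
  rw [hr] at h
  exact h.2 z ((mem_flag_iff_mem_filt r).1 hz)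

variable [Fact p.Prime] (hχr : ∀ z ∈ flag K p l ((r + 1) * (l + 1)), χ z = 0) {s : ℕ} (hs1 : 1 ≤ s)
  (hs : r ≤ 2 * s + 1)

include hχr hs1 hs

/-- The character of `U_χ(W_{ℓ,(s)})` given by `χ`. -/
theorem exists_character : ∃ ε : UχFilt χ s →ₐ[K] K,
    ∀ x : filt K p l s, ε (ιFilt χ s x) = χ (x : WittCurrent K p l) := by
  refine exists_algHom (L := filt K p l s) (χ ∘ₗ (filt K p l s).toSubmodule.subtype)
    (fun a b => ?_) (fun a => ?_)
  · rw [mul_comm, sub_self]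
    exact apply_lie_eq_zero hχr hs ((mem_flag_iff_mem_filt s).2 a.2)
      ((mem_flag_iff_mem_filt s).2 b.2)
  · have h0 : restrictPMap (pMap K p l) (filt K p l s) (pMap_mem_filt K p l s) a = 0 :=
      Subtype.ext (pMap_eq_zero hs1 a.2)
    rw [h0, map_zero, zero_add]
    rfl

/-- A representation of `W_{ℓ,(s)}` with `p`-character `χ` has a common eigenvector with
eigenvalues given by `χ`: the operators `y - χ(y)` are nilpotent, as `y ^ [p] = 0`. -/
theorem exists_eigenvector {M : Type*} [AddCommGroup M] [Module K M] [Nontrivial M]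
    (ρ : filt K p l s →ₗ[K] Module.End K M)
    (hlie : ∀ a b : filt K p l s, ρ ⁅a, b⁆ = ρ a * ρ b - ρ b * ρ a)
    (hpow : ∀ a : filt K p l s, ρ a ^ p =
      ρ (restrictPMap (pMap K p l) (filt K p l s) (pMap_mem_filt K p l s) a) +
        algebraMap K (Module.End K M) (χ a ^ p)) :
    ∃ v : M, v ≠ 0 ∧ ∀ a : filt K p l s, ρ a v = χ a • v := by
  have := finite_wittCurrent K p l
  have : Module.Finite K (filt K p l s) :=
    inferInstanceAs (Module.Finite K (filt K p l s).toSubmodule)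
  refine exists_common_eigenvector (χ ∘ₗ (filt K p l s).toSubmodule.subtype) ρ hlie
    (fun a b => apply_lie_eq_zero hχr hs ((mem_flag_iff_mem_filt s).2 a.2)
      ((mem_flag_iff_mem_filt s).2 b.2)) (fun a => ⟨p, ?_⟩)
  have h0 : restrictPMap (pMap K p l) (filt K p l s) (pMap_mem_filt K p l s) a = 0 :=
    Subtype.ext (pMap_eq_zero hs1 a.2)
  have : CharP (Module.End K M) p :=
    charP_of_injective_algebraMap (algebraMap K (Module.End K M)).injective p
  rw [sub_pow_char_of_commute _ (Algebra.commute_algebraMap_right _ _), hpow, h0, map_zero,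
    zero_add, map_pow]
  exact sub_self _

/-- Every simple `U_χ(W_{ℓ,(s)})`-module is spanned by a common eigenvector. -/
theorem nonempty_equiv_charModule {ε : UχFilt χ s →ₐ[K] K}
    (hε : ∀ x : filt K p l s, ε (ιFilt χ s x) = χ (x : WittCurrent K p l))
    (N : Type*) [AddCommGroup N] [Module (UχFilt χ s) N] [IsSimpleModule (UχFilt χ s) N] :
    Nonempty (N ≃ₗ[UχFilt χ s] CharModule ε) := by
  let _ : Module K N := Module.compHom N (algebraMap K (UχFilt χ s))
  have : IsScalarTower K (UχFilt χ s) N := .of_algebraMap_smul fun _ _ => rfl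
  have : Nontrivial N := IsSimpleModule.nontrivial (UχFilt χ s) N
  obtain ⟨v, hv0, hv⟩ := exists_eigenvector hχr hs1 hs
    (toRep p (restrictPMap (pMap K p l) (filt K p l s) (pMap_mem_filt K p l s))
      (χ ∘ₗ (filt K p l s).toSubmodule.subtype) N) (toRep_lie N) (toRep_pow N)
  have hev : ∀ w : UχFilt χ s, w • v = ε w • v :=
    apply_eq_smul_of_forall_ι (Algebra.lsmul K K N) ε fun a => by
      rw [hε a]; exact hv a
  let f : CharModule ε →ₗ[UχFilt χ s] N :=
    { toFun := fun c => CharModule.toField ε c • v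
      map_add' := fun a b => by rw [map_add, add_smul]
      map_smul' := fun w c => by
        rw [CharModule.toField_smul, RingHom.id_apply, smul_algebra_smul_comm, hev, smul_smul,
          mul_comm] }
  refine ⟨(LinearEquiv.ofBijective f ⟨?_, ?_⟩).symm⟩
  · rw [injective_iff_map_eq_zero]
    intro c hc
    exact (CharModule.toField ε).map_eq_zero_iff.1 ((smul_eq_zero.1 hc).resolve_right hv0)
  · rw [← LinearMap.range_eq_top]
    refine (eq_bot_or_eq_top _).resolve_left fun h => hv0 ?_
    have h1 : v ∈ LinearMap.range f :=
      ⟨(CharModule.toField ε).symm 1, by simp [f]⟩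
    rwa [h, Submodule.mem_bot] at h1

variable {ε : UχFilt χ s →ₐ[K] K}
  (hε : ∀ x : filt K p l s, ε (ιFilt χ s x) = χ (x : WittCurrent K p l))

include hε

/-- A common eigenvector of `W_{ℓ,(s)}` in a `U_χ(W_ℓ)`-module. -/
theorem exists_eigenvector_inclFilt (M : Type*) [AddCommGroup M] [Module K M] [Module (Uχ χ) M]
    [IsScalarTower K (Uχ χ) M] [Nontrivial M] :
    ∃ v : M, v ≠ 0 ∧ ∀ w, inclFilt χ s w • v = ε w • v := by
  obtain ⟨v, hv0, hv⟩ := exists_eigenvector hχr hs1 hs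
    (toRep p (pMap K p l) χ M ∘ₗ (filt K p l s).toSubmodule.subtype)
    (fun a b => toRep_lie M (a : WittCurrent K p l) b)
    (fun a => toRep_pow M (a : WittCurrent K p l))
  refine ⟨v, hv0, apply_eq_smul_of_forall_ι ((Algebra.lsmul K K M).comp (inclFilt χ s)) ε
    fun a => ?_⟩
  rw [hε a, AlgHom.comp_apply, ofSubalgebra_ι]
  exact hv a

/-- The generator of the induced module is non-zero: it maps to an eigenvector in a non-zero
module with `p`-character `χ`. -/
theorem inducedModule_one_ne_zero : InducedModule.one (inclFilt χ s) ε ≠ 0 := by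
  obtain ⟨M, _, _, ρ, _, hρ, -⟩ := exists_isReducedRep hχr hs1 hs 0 (Nat.zero_le _)
  obtain ⟨F, hF⟩ := exists_algHom (P := pMap K p l) (χ := χ) ρ
    (fun a b => hρ.lie a (mem_flag_zero a) b (mem_flag_zero b))
    (fun a => hρ.pow a (mem_flag_zero a))
  let _ : Module (Uχ χ) M := Module.compHom M F.toRingHom
  have hsm : ∀ (u : Uχ χ) (v : M), u • v = F u v := fun _ _ => rfl
  have : IsScalarTower K (Uχ χ) M := ⟨fun c u v => by
    rw [hsm, hsm, map_smul, LinearMap.smul_apply]⟩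
  obtain ⟨v, hv0, hv⟩ := exists_eigenvector_inclFilt hχr hs1 hs hε M
  obtain ⟨f, hf⟩ := InducedModule.exists_lift hv
  intro h
  rw [h, map_zero] at hf
  exact hv0 hf.symm

end

section

variable {K : Type*} [Field K] {p l : ℕ} [CharP K p] [Fact p.Prime]
  {χ : Module.Dual K (WittCurrent K p l)} {r : ℕ}
  (hχr : ∀ z ∈ flag K p l ((r + 1) * (l + 1)), χ z = 0)
  (hχ : χ (basisElt K p l ((r + 1) * (l + 1) - 1)) ≠ 0) (hr1 : 1 < r) (hr2 : r < p - 1)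
  {s : ℕ} (hs1 : 1 ≤ s) (hs2 : 2 * s ≤ r) (hs : r ≤ 2 * s + 1)
  {ε : UχFilt χ s →ₐ[K] K}
  (hε : ∀ x : filt K p l s, ε (ιFilt χ s x) = χ (x : WittCurrent K p l))

include hχr hχ hr1 hr2 hs1 hs2 hε

/-- Every common eigenvector lies in a submodule of dimension `p ^ ((ℓ + 1)(s + 1))`. -/
theorem exists_submodule_finrank {M : Type*} [AddCommGroup M] [Module K M] [Module (Uχ χ) M]
    [IsScalarTower K (Uχ χ) M] {v : M} (hv0 : v ≠ 0)
    (hv : ∀ w, inclFilt χ s w • v = ε w • v) :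
    ∃ V : Submodule (Uχ χ) M, v ∈ V ∧ FiniteDimensional K V ∧
      Module.finrank K V = p ^ ((l + 1) * (s + 1)) := by
  obtain ⟨V, hvV, hfin, hrank, hstab, -, -⟩ := exists_stable_of_eigenvector
    (isReducedRep_toRep (p := p) (P := pMap K p l) (χ := χ) M) hχr hχ hr1 hr2 hs2 hs1 hv0
    (fun y hy => by
      have h := hv (ιFilt χ s ⟨y, (mem_flag_iff_mem_filt s).1 hy⟩)
      rw [ofSubalgebra_ι, hε] at h
      exact h) (Nat.zero_le _)
  rw [Nat.sub_zero, mul_comm] at hrank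
  have hsmul : ∀ (u : Uχ χ) {v : M}, v ∈ V → u • v ∈ V :=
    smul_mem_of_forall_ι fun a v hv => hstab a (mem_flag_zero a) v hv
  exact ⟨{ V with smul_mem' := fun u _ h => hsmul u h }, hvV, hfin, hrank⟩

include hs

theorem finrank_inducedModule :
    FiniteDimensional K (InducedModule (inclFilt χ s) (CharModule ε)) ∧
    Module.finrank K (InducedModule (inclFilt χ s) (CharModule ε)) = p ^ ((l + 1) * (s + 1)) := by
  obtain ⟨V, hv, hfin, hrank⟩ := exists_submodule_finrank hχr hχ hr1 hr2 hs1 hs2 hε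
    (inducedModule_one_ne_zero hχr hs1 hs hε) (InducedModule.smul_one _ _)
  have htop : V = ⊤ := by
    rw [eq_top_iff, ← InducedModule.span_one, Submodule.span_singleton_le_iff_mem]
    exact hv
  subst htop
  let e : (⊤ : Submodule (Uχ χ) (InducedModule (inclFilt χ s) (CharModule ε))) ≃ₗ[K] _ :=
    Submodule.topEquiv.restrictScalars K
  exact ⟨Module.Finite.equiv e, by rw [← e.finrank_eq, hrank]⟩

/-- The induced module is simple: a non-zero submodule contains a common eigenvector, and
with it a submodule of full dimension. -/
theorem isSimpleModule_inducedModule :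
    IsSimpleModule (Uχ χ) (InducedModule (inclFilt χ s) (CharModule ε)) := by
  obtain ⟨hfin, hrank⟩ := finrank_inducedModule hχr hχ hr1 hr2 hs1 hs2 hs hε
  have : Nontrivial (InducedModule (inclFilt χ s) (CharModule ε)) :=
    ⟨_, _, inducedModule_one_ne_zero hχr hs1 hs hε⟩
  refine (isSimpleModule_iff _ _).2
    { eq_bot_or_eq_top := fun N => or_iff_not_imp_left.2 fun hN => ?_ }
  have : Nontrivial N := Submodule.nontrivial_iff_ne_bot.2 hN
  obtain ⟨v, hv0, hv⟩ := exists_eigenvector_inclFilt hχr hs1 hs hε N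
  obtain ⟨V, -, hVfin, hV⟩ := exists_submodule_finrank hχr hχ hr1 hr2 hs1 hs2 hε hv0 hv
  have hle : Module.finrank K V ≤ Module.finrank K (N.restrictScalars K) :=
    LinearMap.finrank_le_finrank_of_injective (f := (V.subtype.restrictScalars K))
      (Submodule.subtype_injective V)
  have h : N.restrictScalars K = ⊤ := Submodule.eq_top_of_finrank_eq
    (le_antisymm (Submodule.finrank_le _) (by rw [hrank, ← hV]; exact hle))
  exact (Submodule.restrictScalars_eq_top_iff K _ _).1 h

theorem nonempty_equiv_inducedModule (M : Type*) [AddCommGroup M] [Module (Uχ χ) M]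
    [IsSimpleModule (Uχ χ) M] :
    Nonempty (M ≃ₗ[Uχ χ] InducedModule (inclFilt χ s) (CharModule ε)) := by
  have := isSimpleModule_inducedModule hχr hχ hr1 hr2 hs1 hs2 hs hε
  let _ : Module K M := Module.compHom M (algebraMap K (Uχ χ))
  have : IsScalarTower K (Uχ χ) M := .of_algebraMap_smul fun _ _ => rfl
  have : Nontrivial M := IsSimpleModule.nontrivial (Uχ χ) M
  obtain ⟨v, hv0, hv⟩ := exists_eigenvector_inclFilt hχr hs1 hs hε M
  obtain ⟨f, hf⟩ := InducedModule.exists_lift hv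
  have hf0 : f ≠ 0 := by
    rintro rfl
    exact hv0 hf.symm
  exact ⟨(LinearEquiv.ofBijective f (LinearMap.bijective_of_ne_zero hf0)).symm⟩

end

end WittCurrent

end

theorem mainTheorem4 {K : Type*} [Field K] [IsAlgClosed K] {p : ℕ} [Fact p.Prime]
    [CharP K p] (hp : 3 < p) (l : ℕ) (χ : Module.Dual K (WittCurrent K p l)) (r : ℕ)
    (hr : WittCurrent.height K p l χ = (r : ℤ)) (hr1 : 1 < r) (hr2 : r < p - 1)
    (hχ : χ (WittCurrent.et K p l ((r : ℤ) - 1) l) ≠ 0) :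
    ∃ ε : WittCurrent.UχFilt χ (r / 2) →ₐ[K] K,
      (∀ x : WittCurrent.filt K p l (r / 2),
        ε (WittCurrent.ιFilt χ (r / 2) x) = χ (x : WittCurrent K p l)) ∧
      (∀ (N : Type*) [AddCommGroup N] [Module (WittCurrent.UχFilt χ (r / 2)) N],
        IsSimpleModule (WittCurrent.UχFilt χ (r / 2)) N →
          Nonempty (N ≃ₗ[WittCurrent.UχFilt χ (r / 2)] CharModule ε)) ∧
      IsSimpleModule (WittCurrent.Uχ χ)
        (InducedModule (WittCurrent.inclFilt χ (r / 2)) (CharModule ε)) ∧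
      (∀ (M : Type*) [AddCommGroup M] [Module (WittCurrent.Uχ χ) M],
        IsSimpleModule (WittCurrent.Uχ χ) M →
          Nonempty (M ≃ₗ[WittCurrent.Uχ χ]
            InducedModule (WittCurrent.inclFilt χ (r / 2)) (CharModule ε))) ∧
      Module.finrank K (InducedModule (WittCurrent.inclFilt χ (r / 2)) (CharModule ε)) =
        p ^ ((l + 1) * (r / 2 + 1)) := by
  have hχr : ∀ z ∈ WittCurrent.flag K p l ((r + 1) * (l + 1)), χ z = 0 := fun z hz =>
    WittCurrent.apply_eq_zero_of_height_eq hr hr1 hz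
  have hχ' : χ (WittCurrent.basisElt K p l ((r + 1) * (l + 1) - 1)) ≠ 0 := by
    rw [WittCurrent.et_eq_basisElt le_rfl] at hχ
    rwa [show (r + 1) * (l + 1) - 1 = r * (l + 1) + l by rw [add_mul]; omega]
  have hs1 : 1 ≤ r / 2 := by omega
  have hs2 : 2 * (r / 2) ≤ r := by omega
  have hs : r ≤ 2 * (r / 2) + 1 := by omega
  obtain ⟨ε, hε⟩ := WittCurrent.exists_character hχr hs1 hs
  exact ⟨ε, hε, fun N _ _ _ => WittCurrent.nonempty_equiv_charModule hχr hs1 hs hε N,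
    WittCurrent.isSimpleModule_inducedModule hχr hχ' hr1 hr2 hs1 hs2 hs hε,
    fun M _ _ _ => WittCurrent.nonempty_equiv_inducedModule hχr hχ' hr1 hr2 hs1 hs2 hs hε M,
    (WittCurrent.finrank_inducedModule hχr hχ' hr1 hr2 hs1 hs2 hs hε).2⟩
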